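/- **Setting.** Let $N\ge 2$ and $n=2N+1$. For $u\in\mathbb R$, $v>0$ let $\Delta_j(u,v)=\int_{\mathbb R}\xi^j\,\frac{1}{\sqrt{2\pi v}}e^{-(\xi-u)^2/(2v)}\,d\xi$. For $W=(w_1,u_1,\dots,w_N,u_N,\sigma^2)$ put $M_j(W)=\sum_{i=1}^N w_i\Delta_j(u_i,\sigma^2)$ and $\mathcal M(W)=(M_0(W),\dots,M_{2N}(W))$. Let $\Omega_W^{open}=\{w_i>0,\ \sigma^2>0,\ u_i\neq u_j\ (i\ne j)\}$, $\Omega_W^{eq}=\{w_i>0,\ \sigma^2>0,\ u_1=\dots=u_N\}$, $\Omega_W=\Omega_W^{open}\cup\Omega_W^{eq}$. The closing moment is the function $\bar M_{2N+1}(\mathcal M(W))=\sum_i w_i\Delta_{2N+1}(u_i,\sigma^2)$, $W\in\Omega_W$. The matrix $A(M)$, $M\in\mathcal M(\Omega_W)$, is the $n\times n$ matrix with ones on the superdiagonal, last row $(a_0,\dots,a_{2N})$ and all other entries zero. Here $a_j=\partial\bar M_{2N+1}/\partial M_j$ on $\mathcal M(\Omega_W^{open})$, and at $M=\mathcal M(W)$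 with $W\in\Omega_W^{eq}$ the number $a_j$ is the limit of $a_j(\mathcal M(W'))$ as $W'\to W$, $W'\in\Omega_W^{open}$. For a moment vector $M$ define $\rho,U,\theta,q$ by $M_0=\rho$, $M_1=\rho U$, $M_2=\rho(U^2+\theta)$, $M_3=\rho(U^3+3U\theta)+2q$. The BGK source is $S(M)=\rho\,(\Delta_0(U,\theta),\dots,\Delta_{2N}(U,\theta))^T-M$. For a Prandtl number $Pr>0$ the Shakhov source is $S^{Sh}(M)=\big(\int_{\mathbb R}\xi^jf_S\,d\xi\big)_{0\le j\le 2N}-M$ with $f_S=f_{eq}\big(1+\frac{(1-Pr)q(\xi-U)}{3\rho\theta^2}\big(\frac{(\xi-U)^2}{\theta}-3\big)\big)$, $f_{eq}=\frac{\rho}{\sqrt{2\pi\theta}}e^{-(\xi-U)^2/(2\theta)}$. The collision frequency $\nu(M)$ is any function that is positive on $\mathcal M(\Omega_W)$ and differentiable at the points of $\mathcal M(\Omega_W^{eq})$, for example a positive constant. The EQMOM systems are $\partial_tM+A(M)\partial_xM=\nu S(M)$ (BGK) and $\partial_tM+A(M)\partial_xM=\nu S^{Sh}(M)$ (Shakhov).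 **Structural stability condition** for $\partial_tM+A(M)\partial_xM=R(M)$ on $\mathbb G\subset\mathbb R^n$, with non-empty equilibrium manifold $\mathcal E=\{M\in\mathbb G: R(M)=0\}$, $R$ differentiable at the points of $\mathcal E$, and Jacobian $R_M$: for some $0<r\le n$, (i) there are invertible matrices $P(M)$ ($n\times n$) and $\hat T(M)$ ($r\times r$) with $P R_M=\mathrm{diag}(0,\hat T)P$ on $\mathcal E$; (ii) there is a symmetric positive definite $A_0(M)$ with $A_0A=A^TA_0$ on $\mathbb G$; (iii) $A_0R_M+R_M^TA_0\le -P^T\mathrm{diag}(0,I_r)P$ on $\mathcal E$. **Theorem.** The closing moment $\bar M_{2N+1}$ is well defined on $\mathcal M(\Omega_W)$; the set $\mathcal M(\Omega_W^{open})$ is open and $\bar M_{2N+1}$ is differentiable on it; and the limits defining $A$ at equilibrium exist and depend only on $M$. Moreover: 1. For $W\in\Omega_W$ one has $S(\mathcal M(W))=0$ if and only if $W\in\Omega_W^{eq}$, and for every $Pr>0$ also $S^{Sh}(\mathcal M(W))=0$ if and only if $W\in\Omega_W^{eq}$. In that case $u_1=\dots=u_N=U$, $\sigma^2=\theta$, $\sum_iw_i=\rho$.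 2. For every $M\in\mathcal M(\Omega_W)$, $A(M)$ has $n$ distinct real eigenvalues $\lambda_1<\dots<\lambda_n$. Let $L(M)$ be the matrix whose $i$-th row is the left eigenvector for $\lambda_i$ with last component $1$. 3. For all $\nu$ as above and all $Pr>0$, both the BGK and the Shakhov system satisfy the structural stability condition (i)–(iii) on $\mathbb G=\mathcal M(\Omega_W)$, with $r=2N-2$ and, for both models, with $A_0=L^TL$. In detail, let $$P=\begin{bmatrix}I_3&0\\-\hat S_M&I_{2N-2}\end{bmatrix},\qquad \hat S_M=\Big(\frac{\partial(\rho\Delta_i(U,\theta))}{\partial M_j}\Big)_{3\le i\le 2N,\ 0\le j\le 2},\qquad (P^S)^{-1}=P^{-1}+\sum_{i=4}^{2N}\binom i3\Delta_{i-3}(U,\theta)E_{i+1,4},$$ where $E_{kl}$ is the matrix unit. Then, for a suitable function $c(M)>0$ (depending on the model, $\nu$ and $Pr$), the conditions hold for BGK with the diagonalizer $\mathrm{diag}(I_3,cI_{2N-2})P$ and $\hat T=-\nu I_{2N-2}$, and for Shakhov with the diagonalizer $\mathrm{diag}(I_3,cI_{2N-2})P^S$ and $\hat T=-\nu\,\mathrm{diag}(Pr,1,\dots,1)$.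 4. At every $M\in\mathcal M(\Omega_W^{eq})$ the first three columns of $LP^{-1}$ are orthogonal to its other columns, and the first three columns of $L(P^S)^{-1}$ are orthogonal to its other columns. -/

import Mathlib

open Filter Topology

noncomputable section

/-! ## Relaxation systems and the structural stability condition -/

/-- The Jacobian matrix of a map `S : ℝⁿ → ℝⁿ` at `M`. -/
def jacobianMatrix {n : ℕ} (S : (Fin n → ℝ) → (Fin n → ℝ)) (M : Fin n → ℝ) :
    Matrix (Fin n) (Fin n) ℝ :=
  LinearMap.toMatrix' (fderiv ℝ S M : (Fin n → ℝ) →ₗ[ℝ] (Fin n → ℝ))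

/-- The equilibrium manifold: the states in `G` where the source vanishes. -/
def equilibriumManifold {n : ℕ} (G : Set (Fin n → ℝ)) (S : (Fin n → ℝ) → (Fin n → ℝ)) :
    Set (Fin n → ℝ) :=
  {M | M ∈ G ∧ S M = 0}

/-- The `n × n` block matrix `diag(0, T)` whose lower right block is the `r × r` matrix `T`,
where `n = m + r`. -/
def lowerBlock {n m r : ℕ} (h : m + r = n) (T : Matrix (Fin r) (Fin r) ℝ) :
    Matrix (Fin n) (Fin n) ℝ :=
  Matrix.reindex (finSumFinEquiv.trans (finCongr h)) (finSumFinEquiv.trans (finCongr h))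
    (Matrix.fromBlocks 0 0 0 T)

/-- The structural stability condition for `∂ₜ M + ∑_d A_d(M) ∂_{x_d} M = S(M)`, `M ∈ G ⊆ ℝⁿ`,
with the given matrices `P(M)`, `T(M)` (of size `r × r`, `0 < r`, `m + r = n`) and `A₀(M)`.
The inequality between symmetric matrices in `coupling` is the Loewner order. -/
structure StructuralStabilityWith {n D m r : ℕ} (h : m + r = n) (G : Set (Fin n → ℝ))
    (A : Fin D → (Fin n → ℝ) → Matrix (Fin n) (Fin n) ℝ)
    (S : (Fin n → ℝ) → (Fin n → ℝ))
    (P : (Fin n → ℝ) → Matrix (Fin n) (Fin n) ℝ)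
    (T : (Fin n → ℝ) → Matrix (Fin r) (Fin r) ℝ)
    (A₀ : (Fin n → ℝ) → Matrix (Fin n) (Fin n) ℝ) : Prop where
  rank_pos : 0 < r
  equilibrium_nonempty : (equilibriumManifold G S).Nonempty
  differentiable : ∀ M ∈ equilibriumManifold G S, DifferentiableAt ℝ S M
  /-- Condition (i). -/
  diagonalize : ∀ M ∈ equilibriumManifold G S, IsUnit (P M) ∧ IsUnit (T M) ∧
    P M * jacobianMatrix S M = lowerBlock h (T M) * P M
  /-- Condition (ii). -/
  symmetrizer : ∀ M ∈ G, (A₀ M).PosDef ∧ ∀ d, A₀ M * A d M = (A d M).transpose * A₀ M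
  /-- Condition (iii). -/
  coupling : ∀ M ∈ equilibriumManifold G S,
    (-((P M).transpose * lowerBlock h (1 : Matrix (Fin r) (Fin r) ℝ) * P M)
      - (A₀ M * jacobianMatrix S M + (jacobianMatrix S M).transpose * A₀ M)).PosSemidef

/-- The structural stability condition: suitable `r`, `P`, `T` and `A₀` exist. -/
def StructuralStability {n D : ℕ} (G : Set (Fin n → ℝ))
    (A : Fin D → (Fin n → ℝ) → Matrix (Fin n) (Fin n) ℝ)
    (S : (Fin n → ℝ) → (Fin n → ℝ)) : Prop :=
  ∃ (m r : ℕ) (h : m + r = n) (P : (Fin n → ℝ) → Matrix (Fin n) (Fin n) ℝ)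
    (T : (Fin n → ℝ) → Matrix (Fin r) (Fin r) ℝ)
    (A₀ : (Fin n → ℝ) → Matrix (Fin n) (Fin n) ℝ),
    StructuralStabilityWith h G A S P T A₀

namespace EQMOM

/-! ## Gaussian moments, the moment map and its domain -/

/-- The normalized Gaussian density with mean `u` and variance `v`. -/
def gaussDensity (u v ξ : ℝ) : ℝ :=
  (Real.sqrt (2 * Real.pi * v))⁻¹ * Real.exp (-(ξ - u) ^ 2 / (2 * v))

/-- `Δ_j(u, v)`: the `j`-th moment of the Gaussian density with mean `u` and variance `v`. -/
def gaussMoment (j : ℕ) (u v : ℝ) : ℝ := ∫ ξ : ℝ, ξ ^ j * gaussDensity u v ξ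

/-- Parameters `W = (w, u, σ²)`: weights, nodes and the common variance. -/
abbrev Params (N : ℕ) : Type := (Fin N → ℝ) × (Fin N → ℝ) × ℝ

/-- Moment vectors `M = (M_0, …, M_{2N})`. -/
abbrev Moments (N : ℕ) : Type := Fin (2 * N + 1) → ℝ

/-- The `j`-th moment of `∑ i, w_i δ_{σ²}(·; u_i)`. -/
def paramMoment {N : ℕ} (j : ℕ) (W : Params N) : ℝ :=
  ∑ i, W.1 i * gaussMoment j (W.2.1 i) W.2.2

/-- The moment map `W ↦ M = (M_0, …, M_{2N})`. -/
def momentMap (N : ℕ) (W : Params N) : Moments N := fun j => paramMoment (j : ℕ) W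

/-- Positive weights, positive variance, pairwise distinct nodes. -/
def domainOpen (N : ℕ) : Set (Params N) :=
  {W | (∀ i, 0 < W.1 i) ∧ 0 < W.2.2 ∧ ∀ i j, i ≠ j → W.2.1 i ≠ W.2.1 j}

/-- Positive weights, positive variance, all nodes equal. -/
def domainEq (N : ℕ) : Set (Params N) :=
  {W | (∀ i, 0 < W.1 i) ∧ 0 < W.2.2 ∧ ∀ i j, W.2.1 i = W.2.1 j}

/-- `Ω_W`. -/
def domain (N : ℕ) : Set (Params N) := domainOpen N ∪ domainEq N

/-- The state space: the realizable moment vectors. -/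
def stateSpace (N : ℕ) : Set (Moments N) := momentMap N '' domain N

/-! ## The closure and the coefficient matrix -/

open Classical in
/-- The closing moment `M_{2N+1}` as a function of `M = (M_0, …, M_{2N})`: it is computed from any
parameter `W` in the domain that reproduces `M` (and is `0` by convention if there is none). -/
def closingMoment (N : ℕ) (M : Moments N) : ℝ :=
  if h : ∃ W ∈ domain N, momentMap N W = M then paramMoment (2 * N + 1) h.choose else 0

/-- The partial derivatives `∂ M_{2N+1} / ∂ M_j`, `0 ≤ j ≤ 2N`. -/
def closingGradient (N : ℕ) (M : Moments N) : Fin (2 * N + 1) → ℝ :=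
  fun j => fderiv ℝ (closingMoment N) M (Pi.single j 1)

open Classical in
/-- The coefficients `a_0, …, a_{2N}`: the partial derivatives of the closing moment at the moment
vectors of parameters with distinct nodes, and at the moment vectors of parameters with equal nodes
their limit as parameters with distinct nodes approach the latter parameters. -/
def closingCoeff (N : ℕ) (M : Moments N) : Fin (2 * N + 1) → ℝ :=
  if M ∈ momentMap N '' domainOpen N then closingGradient N M
  else limUnder (⨆ W ∈ {W | W ∈ domainEq N ∧ momentMap N W = M}, 𝓝[domainOpen N] W)
    (fun W' => closingGradient N (momentMap N W'))

/-- The coefficient matrix: ones above the diagonal, and last row `(a_0, …, a_{2N})`. -/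
def coeffMatrix (N : ℕ) (M : Moments N) : Matrix (Fin (2 * N + 1)) (Fin (2 * N + 1)) ℝ :=
  fun i j => if (i : ℕ) = 2 * N then closingCoeff N M j
    else if (j : ℕ) = (i : ℕ) + 1 then 1 else 0

/-! ## Macroscopic parameters and the collision terms -/

/-- The component `M_j` of a moment vector, for a natural number `j` (only used for `j ≤ 2N`). -/
def comp {N : ℕ} (M : Moments N) (j : ℕ) : ℝ := if h : j < 2 * N + 1 then M ⟨j, h⟩ else 0

/-- The density `ρ = M_0`. -/
def density {N : ℕ} (M : Moments N) : ℝ := comp M 0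

/-- The velocity `U = M_1 / ρ`. -/
def velocity {N : ℕ} (M : Moments N) : ℝ := comp M 1 / density M

/-- The temperature `θ`, given by `M_2 = ρ (U² + θ)`. -/
def temperature {N : ℕ} (M : Moments N) : ℝ := comp M 2 / density M - velocity M ^ 2

/-- The heat flux `q`, given by `M_3 = ρ (U³ + 3 U θ) + 2 q`. -/
def heatFlux {N : ℕ} (M : Moments N) : ℝ :=
  (comp M 3 - density M * (velocity M ^ 3 + 3 * velocity M * temperature M)) / 2

/-- The moments `ρ Δ_j(U, θ)` of the local equilibrium distribution. -/
def equilibriumMoments (N : ℕ) (M : Moments N) : Moments N :=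
  fun j => density M * gaussMoment (j : ℕ) (velocity M) (temperature M)

/-- The BGK source `S(M) = ρ (Δ_0(U, θ), …, Δ_{2N}(U, θ)) - M` (without collision frequency). -/
def bgkSource (N : ℕ) (M : Moments N) : Moments N := equilibriumMoments N M - M

/-- The Shakhov distribution
`f_S = f_eq (1 + (1 - Pr) q (ξ - U) / (3 ρ θ²) ((ξ - U)² / θ - 3))`. -/
def shakhovDensity (Pr ρ U θ q ξ : ℝ) : ℝ :=
  ρ * gaussDensity U θ ξ *
    (1 + (1 - Pr) * q * (ξ - U) / (3 * ρ * θ ^ 2) * ((ξ - U) ^ 2 / θ - 3))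

/-- The Shakhov source: the moments of `f_S - f` (without collision frequency). -/
def shakhovSource (N : ℕ) (Pr : ℝ) (M : Moments N) : Moments N :=
  fun j => (∫ ξ : ℝ, ξ ^ (j : ℕ) *
    shakhovDensity Pr (density M) (velocity M) (temperature M) (heatFlux M) ξ) - M j

/-! ## The diagonalizers of the source Jacobians -/

/-- The matrix `[I₃, 0; -Ŝ_M, I]`, where `Ŝ_M` consists of the derivatives
`∂ (ρ Δ_i(U, θ)) / ∂ M_j` with `3 ≤ i ≤ 2N` and `0 ≤ j ≤ 2`. -/
def bgkDiagonalizer (N : ℕ) (M : Moments N) : Matrix (Fin (2 * N + 1)) (Fin (2 * N + 1)) ℝ :=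
  fun i j => if i = j then 1
    else if 3 ≤ (i : ℕ) ∧ (j : ℕ) < 3 then -jacobianMatrix (equilibriumMoments N) M i j
    else 0

/-- The inverse of the matrix obtained from the inverse of `bgkDiagonalizer` by adding
`binom(i, 3) Δ_{i-3}(U, θ)`, `4 ≤ i ≤ 2N`, to the fourth column (rows and columns are numbered
from `0` here, so this is column `3`). -/
def shakhovDiagonalizer (N : ℕ) (M : Moments N) :
    Matrix (Fin (2 * N + 1)) (Fin (2 * N + 1)) ℝ :=
  ((bgkDiagonalizer N M)⁻¹ + Matrix.of fun i j : Fin (2 * N + 1) =>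
    if 4 ≤ (i : ℕ) ∧ (j : ℕ) = 3 then
      (Nat.choose (i : ℕ) 3 : ℝ) * gaussMoment ((i : ℕ) - 3) (velocity M) (temperature M)
    else 0)⁻¹

/-- `diag(1, 1, 1, c, …, c)`. -/
def blockScale (N : ℕ) (c : ℝ) : Matrix (Fin (2 * N + 1)) (Fin (2 * N + 1)) ℝ :=
  Matrix.diagonal fun i => if (i : ℕ) < 3 then 1 else c

/-- The first three columns of `B` are orthogonal to all its other columns. -/
def FirstThreeColumnsOrthogonal {N : ℕ}
    (B : Matrix (Fin (2 * N + 1)) (Fin (2 * N + 1)) ℝ) : Prop :=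
  ∀ i j : Fin (2 * N + 1), (i : ℕ) < 3 → 3 ≤ (j : ℕ) → ∑ k, B k i * B k j = 0

end EQMOM

end

noncomputable section
/-! ## The heat operator on polynomials -/

namespace EQMOM

open Polynomial

/-! Integrating a polynomial `p` against the Gaussian with mean `u` and variance `v` gives `heat v
p` evaluated at `u`, where `heat v = exp (v D² / 2)` is invertible with inverse `heat (-v)`. Testing
a mixture with `heat (-σ²) q` therefore yields the discrete sum `∑ w_i q(u_i)`, and the analysis
becomes algebra with polynomials.

Closure. The polynomial `heat (-σ²) (∏ (X - u_i)²)` has degree `2N` and integrates to zero against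
`W`. Positivity of Gaussian integrals of squares then forces any parameter with the same moments to
have the same variance, and its nodes to lie among the `u_i`; division by `∏ (X - u_i)` shows that
all moments agree (`paramEval_eq_of_momentMap_eq`). At distinct nodes the differential of the moment
map is invertible. The monic polynomial `heat (-σ²) ((X - α) ∏ (X - u_i)²)` integrates to zero to
first order under every variation of `W` when `α` is a suitable weighted mean of the nodes. Hence
its coefficients are the numbers `-a_j`, and it is the characteristic polynomial of `A`. As the
nodes merge, so does `α`, which gives the limit at equilibrium.

Hyperbolicity. The backward heat flow turns a product of real linear factors, repeated or not, into
a polynomial with simple real roots: each new factor replaces `p` by `(X - r) p - s p'`, and sign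
changes at the roots of `p` locate the new roots (`exists_roots_sub_derivative`). The rows of `L`
are the coefficients of `∏_{k ≠ i} (X - λ_k)`.

Stability. At equilibrium the characteristic polynomial is the Hermite polynomial of degree `2N +
1`. The jets at `U` of the heat flow of the row polynomials satisfy the Hermite recurrence in `λ_i`,
and Lagrange interpolation makes the `m`-th jet orthogonal to every column of `L` of index above `m`
(`sum_eigenJet_mul_coeff`). The first three columns of `L P⁻¹` are combinations of jets of order at
most two, and the Shakhov correction turns the fourth column into the third jet. So columns of `L
P⁻¹` with different relaxation rates are orthogonal, which is what `exists_coupling` needs for `LᵀL`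
to satisfy condition (iii). -/

/-- The operator `X + v D` on polynomials. -/
def raising (v : ℝ) : Module.End ℝ ℝ[X] :=
  LinearMap.mulLeft ℝ X + v • derivative

/-- The operator `exp (v D² / 2)` on polynomials, characterized by `heat v 1 = 1` and
`heat v ∘ X = (X + v D) ∘ heat v`. -/
def heat (v : ℝ) : ℝ[X] →ₗ[ℝ] ℝ[X] :=
  (LinearMap.applyₗ (1 : ℝ[X])).comp (aeval (raising v)).toLinearMap

lemma heat_X_mul (v : ℝ) (p : ℝ[X]) :
    heat v (X * p) = X * heat v p + C v * derivative (heat v p) := by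
  simp [heat, raising, smul_eq_C_mul]

@[simp] lemma heat_C (v a : ℝ) : heat v (C a) = C a := by
  simp [heat, raising, Algebra.algebraMap_eq_smul_one, smul_eq_C_mul]

@[simp] lemma heat_one (v : ℝ) : heat v 1 = 1 := by
  simpa using heat_C v 1

lemma heat_C_mul (v a : ℝ) (p : ℝ[X]) : heat v (C a * p) = C a * heat v p := by
  rw [← smul_eq_C_mul, map_smul, smul_eq_C_mul]

/-- Induction along multiplication by `X`, matching the recurrence `heat_X_mul`. -/
lemma polynomial_induction_X {P : ℝ[X] → Prop} (p : ℝ[X]) (hC : ∀ a, P (C a))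
    (hadd : ∀ p q, P p → P q → P (p + q)) (hX : ∀ p, P p → P (X * p)) : P p := by
  refine Polynomial.induction_on p hC hadd fun n a h => ?_
  have := hX _ h
  rwa [show X * (C a * X ^ n) = C a * X ^ (n + 1) by ring] at this

/-- `D` has the same commutator with `X + v D` as with `X`. -/
lemma derivative_heat (v : ℝ) (p : ℝ[X]) :
    derivative (heat v p) = heat v (derivative p) := by
  induction p using polynomial_induction_X with
  | hC a => simp
  | hadd p q hp hq => simp [hp, hq]
  | hX p hp =>
    simp only [heat_X_mul, derivative_mul, derivative_X, derivative_C, map_add, hp]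
    simp
    ring

lemma iterate_derivative_heat (v : ℝ) (p : ℝ[X]) (k : ℕ) :
    derivative^[k] (heat v p) = heat v (derivative^[k] p) := by
  induction k with
  | zero => rfl
  | succ k ih => rw [Function.iterate_succ_apply', ih, derivative_heat,
      Function.iterate_succ_apply']

lemma heat_X_sub_C_mul (v r : ℝ) (p : ℝ[X]) :
    heat v ((X - C r) * p) = (X - C r) * heat v p + C v * derivative (heat v p) := by
  rw [sub_mul, map_sub, heat_X_mul, heat_C_mul]
  ring

lemma heat_zero (p : ℝ[X]) : heat 0 p = p := by
  induction p using polynomial_induction_X with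
  | hC a => simp
  | hadd p q hp hq => simp [hp, hq]
  | hX p hp => simp [heat_X_mul, hp]

/-- The semigroup law; with `w = -v` it makes the heat flow invertible, so that Gaussian smoothing
can be undone on polynomials. -/
lemma heat_heat (v w : ℝ) (p : ℝ[X]) : heat v (heat w p) = heat (v + w) p := by
  induction p using polynomial_induction_X with
  | hC a => simp
  | hadd p q hp hq => simp [hp, hq]
  | hX p hp =>
    simp only [heat_X_mul, map_add, heat_C_mul, ← derivative_heat, hp]
    ring

lemma heat_heat_neg (v : ℝ) (p : ℝ[X]) : heat v (heat (-v) p) = p := by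
  rw [heat_heat, add_neg_cancel, heat_zero]

lemma heat_neg_heat (v : ℝ) (p : ℝ[X]) : heat (-v) (heat v p) = p := by
  rw [heat_heat, neg_add_cancel, heat_zero]

lemma degree_heat_X_pow_le (v : ℝ) (n : ℕ) : (heat v (X ^ n)).degree ≤ n := by
  induction n with
  | zero => simp
  | succ n ih =>
    rw [pow_succ', heat_X_mul]
    refine (degree_add_le _ _).trans (max_le ?_ ?_)
    · rw [degree_mul, degree_X]
      push_cast
      rw [add_comm]
      gcongr
    · rw [← smul_eq_C_mul]
      refine (degree_smul_le _ _).trans ((degree_derivative_le).trans (ih.trans ?_))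
      exact_mod_cast Nat.le_succ n

lemma degree_heat_le (v : ℝ) (p : ℝ[X]) : (heat v p).degree ≤ p.degree := by
  conv_lhs => rw [p.as_sum_support_C_mul_X_pow]
  rw [map_sum]
  refine (degree_sum_le _ _).trans (Finset.sup_le fun i hi => ?_)
  rw [heat_C_mul, ← smul_eq_C_mul]
  exact (degree_smul_le _ _).trans ((degree_heat_X_pow_le v i).trans (le_degree_of_mem_supp i hi))

lemma natDegree_heat_le (v : ℝ) (p : ℝ[X]) : (heat v p).natDegree ≤ p.natDegree :=
  natDegree_le_natDegree (degree_heat_le v p)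

lemma derivative_heat_X_pow_succ (v : ℝ) (n : ℕ) :
    derivative (heat v (X ^ (n + 1))) = C ((n : ℝ) + 1) * heat v (X ^ n) := by
  rw [derivative_heat, derivative_X_pow, heat_C_mul]
  simp

/-- Stein's identity. -/
lemma eval_heat_X_sub_C_mul (v u : ℝ) (p : ℝ[X]) :
    (heat v ((X - C u) * p)).eval u = v * (heat v (derivative p)).eval u := by
  rw [heat_X_sub_C_mul, ← derivative_heat]
  simp

end EQMOM
end

noncomputable section
/-! ## Gaussian integrals of polynomials -/

namespace EQMOM

open Polynomial MeasureTheory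

lemma gaussDensity_eq_gaussianPDFReal {v : ℝ} (hv : 0 < v) (u : ℝ) :
    gaussDensity u v = ProbabilityTheory.gaussianPDFReal u v.toNNReal := by
  ext ξ
  simp [gaussDensity, ProbabilityTheory.gaussianPDFReal, hv.le]

lemma gaussDensity_pos {v : ℝ} (hv : 0 < v) (u ξ : ℝ) : 0 < gaussDensity u v ξ := by
  unfold gaussDensity
  positivity

lemma integrable_pow_mul_gaussDensity (j : ℕ) {v : ℝ} (hv : 0 < v) (u : ℝ) :
    Integrable fun ξ : ℝ => ξ ^ j * gaussDensity u v ξ := by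
  have hv' : v.toNNReal ≠ 0 := (Real.toNNReal_pos.mpr hv).ne'
  have h1 := (ProbabilityTheory.memLp_id_gaussianReal (μ := u) (v := v.toNNReal)
    (j : NNReal)).integrable_norm_pow'
  have h2 : Integrable (fun ξ : ℝ => ξ ^ j) (ProbabilityTheory.gaussianReal u v.toNNReal) := by
    refine h1.mono' (by fun_prop) (ae_of_all _ fun ξ => ?_)
    simp
  rw [ProbabilityTheory.gaussianReal_of_var_ne_zero _ hv',
    integrable_withDensity_iff (ProbabilityTheory.measurable_gaussianPDF _ _)
      (ae_of_all _ fun _ => ProbabilityTheory.gaussianPDF_lt_top)] at h2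
  simpa [ProbabilityTheory.toReal_gaussianPDF, ← gaussDensity_eq_gaussianPDFReal hv] using h2

lemma integrable_eval_mul_gaussDensity (p : ℝ[X]) {v : ℝ} (hv : 0 < v) (u : ℝ) :
    Integrable fun ξ : ℝ => p.eval ξ * gaussDensity u v ξ := by
  simp_rw [eval_eq_sum_range, Finset.sum_mul, mul_assoc]
  exact integrable_finsetSum _ fun i _ => (integrable_pow_mul_gaussDensity i hv u).const_mul _

lemma hasDerivAt_gaussDensity {v : ℝ} (hv : 0 < v) (u ξ : ℝ) :
    HasDerivAt (gaussDensity u v) (-(ξ - u) / v * gaussDensity u v ξ) ξ := by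
  unfold gaussDensity
  have h : HasDerivAt (fun ξ : ℝ => -(ξ - u) ^ 2 / (2 * v)) (-(ξ - u) / v) ξ := by
    have := ((((hasDerivAt_id ξ).sub_const u).pow 2).neg).div_const (2 * v)
    convert! this using 1
    simp
    field_simp
    ring
  convert! h.exp.const_mul _ using 1
  ring

/-- Integration by parts against the Gaussian density. -/
lemma integral_sub_mul_eval_mul_gaussDensity (p : ℝ[X]) {v : ℝ} (hv : 0 < v) (u : ℝ) :
    ∫ ξ : ℝ, (ξ * p.eval ξ) * gaussDensity u v ξ =
      u * (∫ ξ : ℝ, p.eval ξ * gaussDensity u v ξ) +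
        v * ∫ ξ : ℝ, (derivative p).eval ξ * gaussDensity u v ξ := by
  have hint := fun q : ℝ[X] => integrable_eval_mul_gaussDensity q hv u
  -- The integrand is the derivative of `v p` times the Gaussian density, which is integrable
  -- together with its derivative.
  have h0 : ∫ ξ : ℝ, (C v * derivative p - (X - C u) * p).eval ξ * gaussDensity u v ξ = 0 := by
    have := integral_eq_zero_of_hasDerivAt_of_integrable
      (f := fun ξ => (C v * p).eval ξ * gaussDensity u v ξ)
      (f' := fun ξ => (C v * derivative p - (X - C u) * p).eval ξ * gaussDensity u v ξ)
      (fun ξ => by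
        convert! ((C v * p).hasDerivAt ξ).mul (hasDerivAt_gaussDensity hv u ξ) using 1
        simp
        field_simp
        ring) (hint _) (hint _)
    exact this
  have h1 : ∀ ξ : ℝ, (ξ * p.eval ξ) * gaussDensity u v ξ =
      u * (p.eval ξ * gaussDensity u v ξ) + v * ((derivative p).eval ξ * gaussDensity u v ξ) -
        (C v * derivative p - (X - C u) * p).eval ξ * gaussDensity u v ξ := by
    intro ξ
    simp
    ring
  simp_rw [h1]
  have i1 := (hint p).const_mul u
  have i2 := (hint (derivative p)).const_mul v
  have i3 : Integrable (fun ξ : ℝ => u * (p.eval ξ * gaussDensity u v ξ) +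
    v * ((derivative p).eval ξ * gaussDensity u v ξ)) := i1.add i2
  rw [integral_sub i3 (hint _), h0, sub_zero, integral_add i1 i2, integral_const_mul,
    integral_const_mul]

lemma integral_gaussDensity {v : ℝ} (hv : 0 < v) (u : ℝ) : ∫ ξ : ℝ, gaussDensity u v ξ = 1 := by
  rw [gaussDensity_eq_gaussianPDFReal hv]
  exact ProbabilityTheory.integral_gaussianPDFReal_eq_one u
    (Real.toNNReal_pos.mpr hv).ne'

/-- Integration by parts gives the Gaussian moments the same three-term recurrence as the heat flow
of powers; hence two consecutive indices in the induction. -/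
lemma gaussMoment_eq_and_succ {v : ℝ} (hv : 0 < v) (u : ℝ) (j : ℕ) :
    gaussMoment j u v = (heat v (X ^ j)).eval u ∧
      gaussMoment (j + 1) u v = (heat v (X ^ (j + 1))).eval u := by
  have key : ∀ j, gaussMoment (j + 1) u v = u * gaussMoment j u v +
      v * ∫ ξ : ℝ, (derivative (X ^ j : ℝ[X])).eval ξ * gaussDensity u v ξ := by
    intro j
    have := integral_sub_mul_eval_mul_gaussDensity (X ^ j) hv u
    simp only [eval_pow, eval_X, ← pow_succ'] at this
    exact this
  have h0 : gaussMoment 0 u v = 1 := by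
    simp [gaussMoment, integral_gaussDensity hv]
  induction j with
  | zero =>
    have hX : heat v X = X := by simpa using heat_X_mul v 1
    simp [key, h0, hX]
  | succ j ih =>
    refine ⟨ih.2, ?_⟩
    have e : ∫ ξ : ℝ, (derivative (X ^ (j + 1) : ℝ[X])).eval ξ * gaussDensity u v ξ =
        (j + 1) * gaussMoment j u v := by
      simp [gaussMoment, mul_assoc, integral_const_mul]
    rw [key, ih.2, e, ih.1, pow_succ' X (j + 1), heat_X_mul, derivative_heat_X_pow_succ]
    simp

lemma gaussMoment_eq {v : ℝ} (hv : 0 < v) (u : ℝ) (j : ℕ) :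
    gaussMoment j u v = (heat v (X ^ j)).eval u :=
  (gaussMoment_eq_and_succ hv u j).1

/-- The bridge between analysis and algebra: after this, Gaussian integrals are evaluations of the
heat flow. -/
lemma integral_eval_mul_gaussDensity (p : ℝ[X]) {v : ℝ} (hv : 0 < v) (u : ℝ) :
    ∫ ξ : ℝ, p.eval ξ * gaussDensity u v ξ = (heat v p).eval u := by
  conv_rhs => rw [p.as_sum_range_C_mul_X_pow]
  simp_rw [eval_eq_sum_range (p := p), Finset.sum_mul, mul_assoc, map_sum, heat_C_mul,
    eval_finsetSum, eval_mul, eval_C, ← gaussMoment_eq hv]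
  rw [integral_finsetSum _ fun i _ => (integrable_pow_mul_gaussDensity i hv u).const_mul _]
  simp_rw [integral_const_mul, gaussMoment]

/-- The value is the Gaussian integral of a nonnegative continuous function that is not identically
zero. -/
lemma eval_heat_sq_pos {q : ℝ[X]} (hq : q ≠ 0) {v : ℝ} (hv : 0 < v) (u : ℝ) :
    0 < (heat v (q ^ 2)).eval u := by
  rw [← integral_eval_mul_gaussDensity _ hv]
  obtain ⟨x, hx⟩ : ∃ x, q.eval x ≠ 0 := by
    by_contra! h
    exact hq (funext fun x => by simp [h x])
  refine integral_pos_of_integrable_nonneg_nonzero (x := x) ?_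
    (integrable_eval_mul_gaussDensity _ hv u) (fun ξ => ?_) ?_
  · have : Continuous (gaussDensity u v) := by
      unfold gaussDensity
      fun_prop
    exact (q ^ 2).continuous.mul this
  · simp only [eval_pow]
    exact mul_nonneg (sq_nonneg _) (gaussDensity_pos hv u ξ).le
  · simp only [eval_pow]
    exact (mul_pos (by positivity) (gaussDensity_pos hv u x)).ne'

end EQMOM
end

noncomputable section
/-! ## The moments determine the parameters -/

namespace EQMOM

open Polynomial

variable {N : ℕ}

/-- The integral of the polynomial `p` against `∑ i, w_i δ_{σ²}(·; u_i)`. -/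
def paramEval (p : ℝ[X]) (W : Params N) : ℝ :=
  ∑ i, W.1 i * (heat W.2.2 p).eval (W.2.1 i)

lemma paramMoment_eq_paramEval (j : ℕ) {W : Params N} (hv : 0 < W.2.2) :
    paramMoment j W = paramEval (X ^ j) W := by
  simp [paramMoment, paramEval, gaussMoment_eq hv]

lemma paramEval_eq_sum (p : ℝ[X]) (W : Params N) {n : ℕ} (hp : p.natDegree < n) :
    paramEval p W = ∑ j ∈ Finset.range n, p.coeff j * paramEval (X ^ j) W := by
  conv_lhs => rw [p.as_sum_range_C_mul_X_pow' hp]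
  simp only [paramEval, map_sum, heat_C_mul, eval_finsetSum, eval_mul, eval_C, Finset.mul_sum]
  rw [Finset.sum_comm]
  exact Finset.sum_congr rfl fun j _ => Finset.sum_congr rfl fun i _ => by ring

lemma paramEval_congr {W W' : Params N} (hv : 0 < W.2.2) (hv' : 0 < W'.2.2)
    (h : momentMap N W = momentMap N W') {p : ℝ[X]} (hp : p.natDegree ≤ 2 * N) :
    paramEval p W = paramEval p W' := by
  rw [paramEval_eq_sum p W (Nat.lt_succ_of_le hp), paramEval_eq_sum p W' (Nat.lt_succ_of_le hp)]
  refine Finset.sum_congr rfl fun j hj => ?_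
  have := congrFun h ⟨j, Finset.mem_range.mp hj⟩
  simp only [momentMap, paramMoment_eq_paramEval _ hv, paramMoment_eq_paramEval _ hv'] at this
  rw [this]

/-- Preparing the test polynomial with the backward flow cancels the smoothing of the mixture and
leaves the discrete measure. -/
lemma paramEval_heat_neg (p : ℝ[X]) (W : Params N) :
    paramEval (heat (-W.2.2) p) W = ∑ i, W.1 i * p.eval (W.2.1 i) := by
  simp [paramEval, heat_heat_neg]

/-- The polynomial `∏ i, (X - u_i)`. -/
abbrev nodePoly (u : Fin N → ℝ) : ℝ[X] := Lagrange.nodal Finset.univ u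

lemma eval_nodePoly (u : Fin N → ℝ) (i : Fin N) : (nodePoly u).eval (u i) = 0 :=
  Lagrange.eval_nodal_at_node (Finset.mem_univ i)

lemma natDegree_nodePoly_sq (u : Fin N → ℝ) : (nodePoly u ^ 2).natDegree = 2 * N := by
  rw [Lagrange.nodal_monic.natDegree_pow, Lagrange.natDegree_nodal, Finset.card_univ,
    Fintype.card_fin]

lemma paramEval_heat_neg_nodePoly_sq (W : Params N) :
    paramEval (heat (-W.2.2) (nodePoly W.2.1 ^ 2)) W = 0 := by
  simp [paramEval_heat_neg, eval_nodePoly]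

lemma natDegree_heat_nodePoly_sq_le (v : ℝ) (u : Fin N → ℝ) :
    (heat v (nodePoly u ^ 2)).natDegree ≤ 2 * N :=
  (natDegree_heat_le _ _).trans (natDegree_nodePoly_sq u).le

/-- The test polynomial `heat (-σ²) (∏ (X - u_i)²)` has degree at most `2N` and integrates to zero
against `W`. If `W'` had larger variance, some Gaussian smoothing would remain and the integral
against `W'` would be strictly positive. -/
lemma variance_le_of_momentMap_eq [NeZero N] {W W' : Params N} (hv : 0 < W.2.2)
    (hw' : ∀ i, 0 < W'.1 i) (hv' : 0 < W'.2.2) (h : momentMap N W = momentMap N W') :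
    W'.2.2 ≤ W.2.2 := by
  by_contra! hlt
  have h1 := paramEval_congr hv hv' h (natDegree_heat_nodePoly_sq_le (-W.2.2) W.2.1)
  rw [paramEval_heat_neg_nodePoly_sq, paramEval] at h1
  refine h1.not_lt (Finset.sum_pos (fun i _ => mul_pos (hw' i) ?_) Finset.univ_nonempty)
  rw [heat_heat]
  exact eval_heat_sq_pos Lagrange.nodal_ne_zero (by linarith) _

lemma variance_eq_of_momentMap_eq [NeZero N] {W W' : Params N} (hw : ∀ i, 0 < W.1 i)
    (hv : 0 < W.2.2) (hw' : ∀ i, 0 < W'.1 i) (hv' : 0 < W'.2.2)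
    (h : momentMap N W = momentMap N W') : W'.2.2 = W.2.2 :=
  (variance_le_of_momentMap_eq hv hw' hv' h).antisymm (variance_le_of_momentMap_eq hv' hw hv h.symm)

/-- With equal variances the same test polynomial gives a vanishing sum of the nonnegative terms
`w'_j ∏ (u'_j - u_i)²`. -/
lemma eval_nodePoly_of_momentMap_eq [NeZero N] {W W' : Params N} (hw : ∀ i, 0 < W.1 i)
    (hv : 0 < W.2.2) (hw' : ∀ i, 0 < W'.1 i) (hv' : 0 < W'.2.2)
    (h : momentMap N W = momentMap N W') (j : Fin N) : (nodePoly W.2.1).eval (W'.2.1 j) = 0 := by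
  have h1 := paramEval_congr hv hv' h (natDegree_heat_nodePoly_sq_le (-W.2.2) W.2.1)
  rw [paramEval_heat_neg_nodePoly_sq, ← variance_eq_of_momentMap_eq hw hv hw' hv' h,
    paramEval_heat_neg, eq_comm, Finset.sum_eq_zero_iff_of_nonneg] at h1
  · have := h1 j (Finset.mem_univ j)
    rw [mul_eq_zero, or_iff_right (hw' j).ne', eval_pow] at this
    exact pow_eq_zero_iff two_ne_zero |>.mp this
  · intro i _
    rw [eval_pow]
    exact mul_nonneg (hw' i).le (sq_nonneg _)

lemma exists_node_eq_of_momentMap_eq [NeZero N] {W W' : Params N} (hw : ∀ i, 0 < W.1 i)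
    (hv : 0 < W.2.2) (hw' : ∀ i, 0 < W'.1 i) (hv' : 0 < W'.2.2)
    (h : momentMap N W = momentMap N W') (j : Fin N) : ∃ i, W'.2.1 j = W.2.1 i := by
  have := eval_nodePoly_of_momentMap_eq hw hv hw' hv' h j
  rw [Lagrange.eval_nodal, Finset.prod_eq_zero_iff] at this
  obtain ⟨i, -, hi⟩ := this
  exact ⟨i, sub_eq_zero.mp hi⟩

/-- All moments agree as soon as the first `2N + 1` moments do. -/
lemma paramEval_eq_of_momentMap_eq [NeZero N] {W W' : Params N} (hw : ∀ i, 0 < W.1 i)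
    (hv : 0 < W.2.2) (hw' : ∀ i, 0 < W'.1 i) (hv' : 0 < W'.2.2)
    (h : momentMap N W = momentMap N W') (p : ℝ[X]) : paramEval p W = paramEval p W' := by
  have hvv := variance_eq_of_momentMap_eq hw hv hw' hv' h
  set g := heat W.2.2 p with hg
  -- The remainder agrees with `g` at the nodes of both parameters, since all of them are roots of
  -- the divisor, and its degree is low enough for the shared moments to apply.
  set r := g %ₘ nodePoly W.2.1 with hr
  have hp : p = heat (-W.2.2) g := by rw [hg, heat_neg_heat]
  have hmod : ∀ x, (nodePoly W.2.1).eval x = 0 → g.eval x = r.eval x := by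
    intro x hx
    conv_lhs => rw [← modByMonic_add_div g (nodePoly W.2.1)]
    simp [hx, hr]
  have hdeg : (heat (-W.2.2) r).natDegree ≤ 2 * N := by
    refine (natDegree_heat_le _ _).trans ((natDegree_modByMonic_le g Lagrange.nodal_monic).trans ?_)
    rw [Lagrange.natDegree_nodal, Finset.card_univ, Fintype.card_fin]
    omega
  have key := paramEval_congr hv hv' h hdeg
  rw [paramEval_heat_neg, ← hvv, paramEval_heat_neg] at key
  rw [hp, paramEval_heat_neg, ← hvv, paramEval_heat_neg]
  simp_rw [hmod _ (eval_nodePoly W.2.1 _),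
    hmod _ (eval_nodePoly_of_momentMap_eq hw hv hw' hv' h _)]
  exact key

lemma weight_pos_of_mem_domain {W : Params N} (hW : W ∈ domain N) (i : Fin N) : 0 < W.1 i :=
  hW.elim (fun h => h.1 i) fun h => h.1 i

lemma variance_pos_of_mem_domain {W : Params N} (hW : W ∈ domain N) : 0 < W.2.2 :=
  hW.elim (fun h => h.2.1) fun h => h.2.1

theorem closingMoment_momentMap [NeZero N] {W : Params N} (hW : W ∈ domain N) :
    closingMoment N (momentMap N W) = paramMoment (2 * N + 1) W := by
  have h : ∃ W' ∈ domain N, momentMap N W' = momentMap N W := ⟨W, hW, rfl⟩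
  have hv := variance_pos_of_mem_domain hW
  have hv' := variance_pos_of_mem_domain h.choose_spec.1
  rw [closingMoment, dif_pos h, paramMoment_eq_paramEval _ hv, paramMoment_eq_paramEval _ hv']
  exact paramEval_eq_of_momentMap_eq (weight_pos_of_mem_domain h.choose_spec.1) hv'
    (weight_pos_of_mem_domain hW) hv h.choose_spec.2 _

/-- Every node of `W` would be the single common node of `W'`, but `W` has two distinct nodes. Hence
the two cases in `closingCoeff` do not overlap. -/
lemma momentMap_ne_of_mem (hN : 2 ≤ N) {W W' : Params N} (hW : W ∈ domainOpen N)
    (hW' : W' ∈ domainEq N) : momentMap N W ≠ momentMap N W' := by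
  intro h
  have : NeZero N := ⟨by omega⟩
  have key := exists_node_eq_of_momentMap_eq hW'.1 hW'.2.1 hW.1 hW.2.1 h.symm
  obtain ⟨i, hi⟩ := key ⟨0, by omega⟩
  obtain ⟨j, hj⟩ := key ⟨1, by omega⟩
  refine hW.2.2 ⟨0, by omega⟩ ⟨1, by omega⟩ (by simp) ?_
  rw [hi, hj, hW'.2.2 i j]

end EQMOM
end

noncomputable section
/-! ## Real-rootedness of the backward heat flow -/

namespace EQMOM

open Polynomial

/-- Each sign change yields a root in its own interval, and a monic polynomial of degree `m` with
`m` distinct roots is their nodal polynomial. -/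
lemma eq_nodePoly_of_sign_changes {m : ℕ} {P : ℝ[X]} (hP : P.Monic) (hdeg : P.natDegree = m)
    (y : Fin (m + 1) → ℝ) (hy : StrictMono y)
    (hs : ∀ k : Fin m, P.eval (y k.castSucc) * P.eval (y k.succ) < 0) :
    ∃ ev : Fin m → ℝ, StrictMono ev ∧ P = nodePoly ev := by
  have hroot : ∀ k : Fin m, ∃ z ∈ Set.Ioo (y k.castSucc) (y k.succ), P.eval z = 0 := by
    intro k
    have hle := (hy (Fin.castSucc_lt_succ (i := k))).le
    rcases mul_neg_iff.mp (hs k) with ⟨h1, h2⟩ | ⟨h1, h2⟩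
    · exact intermediate_value_Ioo' hle P.continuous.continuousOn ⟨h2, h1⟩
    · exact intermediate_value_Ioo hle P.continuous.continuousOn ⟨h1, h2⟩
  choose z hz hz0 using hroot
  have hmono : StrictMono z := by
    intro i j hij
    calc z i < y i.succ := (hz i).2
      _ ≤ y j.castSucc := hy.monotone (Fin.le_castSucc_iff.mpr (Fin.succ_lt_succ_iff.mpr hij))
      _ < z j := (hz j).1
  refine ⟨z, hmono, eq_of_degree_sub_lt_of_eval_index_eq Finset.univ hmono.injective.injOn ?_ ?_⟩
  · have hd : P.degree = (m : WithBot ℕ) := by rw [degree_eq_natDegree hP.ne_zero, hdeg]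
    have hd' : (nodePoly z).degree = (m : WithBot ℕ) := by simp [nodePoly, Lagrange.degree_nodal]
    rw [Finset.card_univ, Fintype.card_fin, ← hd]
    exact degree_sub_lt_left (hd.trans hd'.symm) hP.ne_zero
      (hP.leadingCoeff.trans Lagrange.nodal_monic.leadingCoeff.symm)
  · intro i _
    rw [hz0, eval_nodePoly]

/-- The derivative at a node is `∏_{j ≠ i} (λ_i - λ_j)`, with exactly `n - 1 - i` negative factors;
this number has the parity of `n + 1 + i`. -/
lemma derivative_nodePoly_sign {n : ℕ} {ev : Fin n → ℝ} (hev : StrictMono ev) (i : Fin n) :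
    0 < (-1) ^ (n + 1 + (i : ℕ)) * (derivative (nodePoly ev)).eval (ev i) := by
  have hsplit : Finset.univ.erase i = Finset.Iio i ∪ Finset.Ioi i := by
    ext j
    simp [lt_or_lt_iff_ne]
  have hdisj : Disjoint (Finset.Iio i) (Finset.Ioi i) := by
    rw [Finset.disjoint_left]
    intro j h1 h2
    exact (Finset.mem_Iio.mp h1).not_gt (Finset.mem_Ioi.mp h2)
  rw [Lagrange.eval_nodal_derivative_eval_node_eq (Finset.mem_univ i), Lagrange.eval_nodal, hsplit,
    Finset.prod_union hdisj]
  have h1 : 0 < ∏ j ∈ Finset.Iio i, (ev i - ev j) :=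
    Finset.prod_pos fun j hj => sub_pos.mpr (hev (Finset.mem_Iio.mp hj))
  have h2 : 0 < ∏ j ∈ Finset.Ioi i, (ev j - ev i) :=
    Finset.prod_pos fun j hj => sub_pos.mpr (hev (Finset.mem_Ioi.mp hj))
  have h3 : ∏ j ∈ Finset.Ioi i, (ev i - ev j) =
      (-1) ^ (n - 1 - (i : ℕ)) * ∏ j ∈ Finset.Ioi i, (ev j - ev i) := by
    rw [← Fin.card_Ioi, ← Finset.prod_const, ← Finset.prod_mul_distrib]
    exact Finset.prod_congr rfl fun j _ => by ring
  have h4 : (-1 : ℝ) ^ (n + 1 + (i : ℕ)) * (-1) ^ (n - 1 - (i : ℕ)) = 1 := by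
    rw [← pow_add, show n + 1 + (i : ℕ) + (n - 1 - i) = 2 * n by have := i.2; omega, pow_mul]
    simp
  rw [h3]
  calc 0 < (∏ j ∈ Finset.Iio i, (ev i - ev j)) * ∏ j ∈ Finset.Ioi i, (ev j - ev i) := mul_pos h1 h2
    _ = ((-1 : ℝ) ^ (n + 1 + (i : ℕ)) * (-1) ^ (n - 1 - (i : ℕ))) *
        ((∏ j ∈ Finset.Iio i, (ev i - ev j)) * ∏ j ∈ Finset.Ioi i, (ev j - ev i)) := by
      rw [h4, one_mul]
    _ = _ := by ring

lemma eventually_eval_pos {P : ℝ[X]} (hP : P.Monic) (hdeg : 0 < P.natDegree) :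
    ∀ᶠ x in atTop, 0 < P.eval x :=
  (P.tendsto_atTop_of_leadingCoeff_nonneg (natDegree_pos_iff_degree_pos.mp hdeg)
    (by rw [hP.leadingCoeff]; exact zero_le_one)).eventually_gt_atTop 0

lemma eventually_eval_neg_sign {P : ℝ[X]} (hP : P.Monic) (hdeg : 0 < P.natDegree) :
    ∀ᶠ x in atTop, 0 < (-1) ^ P.natDegree * P.eval (-x) := by
  set Q : ℝ[X] := C ((-1) ^ P.natDegree) * P.comp (-X) with hQ
  have hne : ((-1 : ℝ) ^ P.natDegree) ≠ 0 := by simp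
  have hd : Q.natDegree = P.natDegree := by
    rw [hQ, natDegree_C_mul hne, natDegree_comp, natDegree_neg, natDegree_X, mul_one]
  have hm : Q.Monic := by
    rw [Monic, hQ, leadingCoeff_mul, leadingCoeff_C, leadingCoeff_comp (by simp), hP.leadingCoeff]
    simp [← mul_pow]
  filter_upwards [eventually_eval_pos hm (hd ▸ hdeg)] with x hx
  simpa [hQ] using hx

/-- If `p` has simple real roots only, so has `(X - r) p - s p'` for `s > 0`. -/
lemma exists_roots_sub_derivative {n : ℕ} {ev : Fin n → ℝ} (hev : StrictMono ev) (r : ℝ) {s : ℝ}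
    (hs : 0 < s) : ∃ ev' : Fin (n + 1) → ℝ, StrictMono ev' ∧
      (X - C r) * nodePoly ev - C s * derivative (nodePoly ev) = nodePoly ev' := by
  set P := (X - C r) * nodePoly ev - C s * derivative (nodePoly ev) with hPdef
  have hq : ((X - C r) * nodePoly ev).Monic := (monic_X_sub_C r).mul Lagrange.nodal_monic
  have hqd : ((X - C r) * nodePoly ev).natDegree = n + 1 := by
    rw [(monic_X_sub_C r).natDegree_mul Lagrange.nodal_monic, natDegree_X_sub_C,
      Lagrange.natDegree_nodal, Finset.card_univ, Fintype.card_fin, add_comm]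
  have hlt : (C s * derivative (nodePoly ev)).degree < ((X - C r) * nodePoly ev).degree := by
    rw [← smul_eq_C_mul, degree_eq_natDegree hq.ne_zero, hqd]
    refine (degree_smul_le _ _).trans_lt (degree_derivative_le.trans_lt ?_)
    rw [Lagrange.degree_nodal, Finset.card_univ, Fintype.card_fin]
    exact_mod_cast Nat.lt_succ_self n
  have hP : P.Monic := hq.sub_of_left hlt
  have hPd : P.natDegree = n + 1 := by
    rw [← hqd, hPdef, natDegree_eq_of_degree_eq (degree_sub_eq_left_of_degree_lt hlt)]
  have hev_lt : ∀ᶠ x : ℝ in atTop, ∀ i, |ev i| < x :=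
    eventually_all.mpr fun i => eventually_gt_atTop _
  obtain ⟨R, hR1, hR2, hR3, hR0⟩ := ((eventually_eval_pos hP (by omega)).and
    ((eventually_eval_neg_sign hP (by omega)).and (hev_lt.and (eventually_gt_atTop 0)))).exists
  rw [hPd] at hR2
  have hnode : ∀ i, P.eval (ev i) = -(s * (derivative (nodePoly ev)).eval (ev i)) := by
    intro i
    simp [hPdef, eval_nodePoly]
  -- Sampling points: the old roots, framed by `±R` beyond them, where the leading term fixes the
  -- sign. At an old root `P` equals `-s p'`, so its sign alternates along all the points.
  set y : Fin (n + 1 + 1) → ℝ :=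
    Fin.cons (α := fun _ => ℝ) (-R) (Fin.snoc (α := fun _ => ℝ) ev R) with hy
  have hmono : StrictMono y := by
    have h1 : StrictMono (Fin.snoc (α := fun _ => ℝ) ev R) := by
      intro i j hij
      induction j using Fin.lastCases with
      | last =>
        induction i using Fin.lastCases with
        | last => exact absurd hij (lt_irrefl _)
        | cast i => simpa using (abs_lt.mp (hR3 i)).2
      | cast j =>
        induction i using Fin.lastCases with
        | last => exact absurd hij (Fin.castSucc_lt_last j).not_gt
        | cast i => simpa using hev (Fin.castSucc_lt_castSucc_iff.mp hij)
    intro i j hij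
    induction j using Fin.cases with
    | zero => exact absurd hij (Fin.not_lt_zero i)
    | succ j =>
      induction i using Fin.cases with
      | succ i => simpa [hy] using h1 (Fin.succ_lt_succ_iff.mp hij)
      | zero =>
        simp only [hy, Fin.cons_zero, Fin.cons_succ]
        induction j using Fin.lastCases with
        | last => simpa using (by linarith : -R < R)
        | cast j => simpa using (abs_lt.mp (hR3 j)).1
  have hsign : ∀ k : Fin (n + 1 + 1), 0 < (-1) ^ (n + 1 + (k : ℕ)) * P.eval (y k) := by
    intro k
    induction k using Fin.cases with
    | zero => simpa [hy] using hR2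
    | succ k =>
      simp only [hy, Fin.cons_succ, Fin.val_succ]
      induction k using Fin.lastCases with
      | last =>
        simp only [Fin.snoc_last, Fin.val_last]
        rw [← two_mul, pow_mul]
        simpa using hR1
      | cast k =>
        have := mul_pos hs (derivative_nodePoly_sign hev k)
        simp only [Fin.snoc_castSucc, Fin.val_castSucc, hnode]
        calc 0 < _ := this
          _ = _ := by ring
  obtain ⟨ev', h1, h2⟩ := eq_nodePoly_of_sign_changes hP hPd y hmono fun k => by
    have := mul_pos (hsign k.castSucc) (hsign k.succ)
    have e : (-1 : ℝ) ^ (n + 1 + (k : ℕ)) * (-1) ^ (n + 1 + ((k : ℕ) + 1)) = -1 := by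
      rw [← pow_add, show n + 1 + (k : ℕ) + (n + 1 + (k + 1)) = 2 * (n + 1 + k) + 1 by ring,
        pow_succ, pow_mul]
      simp
    simp only [Fin.val_castSucc, Fin.val_succ] at this
    rw [mul_mul_mul_comm, e] at this
    linarith
  exact ⟨ev', h1, h2⟩

/-- The backward heat flow of a product of linear factors has simple real roots. -/
lemma exists_roots_heat_neg {s : ℝ} (hs : 0 < s) (l : List ℝ) :
    ∃ ev : Fin l.length → ℝ, StrictMono ev ∧
      heat (-s) (l.map fun r => X - C r).prod = nodePoly ev := by
  induction l with
  | nil => exact ⟨Fin.elim0, fun i => i.elim0, by simp [nodePoly, Lagrange.nodal]⟩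
  | cons r l ih =>
    obtain ⟨ev, hev, h⟩ := ih
    obtain ⟨ev', hev', h'⟩ := exists_roots_sub_derivative hev r hs
    refine ⟨ev', hev', ?_⟩
    rw [List.map_cons, List.prod_cons, heat_X_sub_C_mul, h, ← h', C_neg]
    ring

end EQMOM
end

noncomputable section
/-! ## The derivative of the moment map and of the closing moment -/

namespace EQMOM

open Polynomial

variable {N : ℕ}

/-- The total derivative of `(u, v) ↦ (heat v p).eval u`. -/
def evalHeatDeriv (p : ℝ[X]) (x : ℝ × ℝ) : ℝ × ℝ →L[ℝ] ℝ :=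
  (derivative (heat x.2 p)).eval x.1 • ContinuousLinearMap.fst ℝ ℝ ℝ +
    (derivative (derivative (heat x.2 p))).eval x.1 • (1 / 2 : ℝ) • ContinuousLinearMap.snd ℝ ℝ ℝ

/-- The factor `1 / 2` in the `v`-derivative is the heat equation `∂_v = D² / 2`. The recurrence for
powers involves two predecessors, so two consecutive powers are carried along. -/
lemma hasStrictFDerivAt_eval_heat_X_pow (x : ℝ × ℝ) (n : ℕ) :
    HasStrictFDerivAt (fun y : ℝ × ℝ => (heat y.2 (X ^ n)).eval y.1) (evalHeatDeriv (X ^ n) x) x ∧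
    HasStrictFDerivAt (fun y : ℝ × ℝ => (heat y.2 (X ^ (n + 1))).eval y.1)
      (evalHeatDeriv (X ^ (n + 1)) x) x := by
  have hX : ∀ v, heat v X = X := fun v => by simpa using heat_X_mul v 1
  induction n with
  | zero =>
    refine ⟨?_, ?_⟩
    · simp only [pow_zero, heat_one, eval_one]
      convert hasStrictFDerivAt_const (1 : ℝ) x using 1
      simp [evalHeatDeriv]
    · simp only [zero_add, pow_one, hX, eval_X]
      rw [show evalHeatDeriv X x = ContinuousLinearMap.fst ℝ ℝ ℝ by simp [evalHeatDeriv, hX]]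
      exact hasStrictFDerivAt_fst
  | succ n ih =>
    refine ⟨ih.2, ?_⟩
    have e : ∀ v, heat v (X ^ (n + 2)) =
        X * heat v (X ^ (n + 1)) + C (v * (n + 1)) * heat v (X ^ n) := by
      intro v
      rw [pow_succ' X (n + 1), heat_X_mul, derivative_heat_X_pow_succ, ← mul_assoc, ← C_mul]
    have h := (hasStrictFDerivAt_fst.mul ih.2).add
      (((hasStrictFDerivAt_snd (𝕜 := ℝ) (p := x)).mul_const ((n : ℝ) + 1)).mul ih.1)
    convert! h using 1
    · ext y
      simp [e]
    · ext
      · simp [evalHeatDeriv, e, derivative_heat_X_pow_succ]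
        ring
      · simp [evalHeatDeriv, e, derivative_heat_X_pow_succ]
        ring

lemma hasStrictFDerivAt_eval_heat (p : ℝ[X]) (x : ℝ × ℝ) :
    HasStrictFDerivAt (fun y : ℝ × ℝ => (heat y.2 p).eval y.1) (evalHeatDeriv p x) x := by
  induction p using Polynomial.induction_on' with
  | add p q hp hq =>
    convert! hp.add hq using 1
    · ext y
      simp
    · ext <;> simp [evalHeatDeriv]
      ring
  | monomial n a =>
    convert! (hasStrictFDerivAt_eval_heat_X_pow x n).1.const_mul a using 1
    · ext y
      simp [← C_mul_X_pow_eq_monomial, heat_C_mul]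
    · ext <;> simp [evalHeatDeriv, ← C_mul_X_pow_eq_monomial, heat_C_mul]
      ring

/-- The total derivative of `W ↦ paramEval p W`. -/
def paramEvalDeriv (W : Params N) : ℝ[X] →ₗ[ℝ] Params N →L[ℝ] ℝ where
  toFun p := ∑ i, (W.1 i • (evalHeatDeriv p (W.2.1 i, W.2.2)).comp
      (((ContinuousLinearMap.proj i).comp ((ContinuousLinearMap.fst ℝ (Fin N → ℝ) ℝ).comp
        (ContinuousLinearMap.snd ℝ (Fin N → ℝ) ((Fin N → ℝ) × ℝ)))).prod
        ((ContinuousLinearMap.snd ℝ (Fin N → ℝ) ℝ).comp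
          (ContinuousLinearMap.snd ℝ (Fin N → ℝ) ((Fin N → ℝ) × ℝ)))) +
    (heat W.2.2 p).eval (W.2.1 i) • (ContinuousLinearMap.proj i).comp
      (ContinuousLinearMap.fst ℝ (Fin N → ℝ) ((Fin N → ℝ) × ℝ)))
  map_add' p q := by
    rw [← Finset.sum_add_distrib]
    refine Finset.sum_congr rfl fun i _ => ?_
    ext d <;> simp [evalHeatDeriv] <;> ring
  map_smul' a p := by
    rw [Finset.smul_sum]
    refine Finset.sum_congr rfl fun i _ => ?_
    ext d <;> simp [evalHeatDeriv] <;> ring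

lemma paramEvalDeriv_apply (W : Params N) (p : ℝ[X]) (d : Params N) :
    paramEvalDeriv W p d = ∑ i, ((heat W.2.2 p).eval (W.2.1 i) * d.1 i +
      W.1 i * ((derivative (heat W.2.2 p)).eval (W.2.1 i) * d.2.1 i +
        (derivative (derivative (heat W.2.2 p))).eval (W.2.1 i) * (1 / 2 * d.2.2))) := by
  simp [paramEvalDeriv, evalHeatDeriv]
  exact Finset.sum_congr rfl fun i _ => by ring

lemma hasStrictFDerivAt_paramEval (p : ℝ[X]) (W : Params N) :
    HasStrictFDerivAt (paramEval p) (paramEvalDeriv W p) W := by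
  unfold paramEval
  refine HasStrictFDerivAt.fun_sum fun i _ => ?_
  have h1 := ((ContinuousLinearMap.proj (R := ℝ) (φ := fun _ : Fin N => ℝ) i).comp
    (ContinuousLinearMap.fst ℝ (Fin N → ℝ) ((Fin N → ℝ) × ℝ))).hasStrictFDerivAt (x := W)
  have h2 := (((ContinuousLinearMap.proj (R := ℝ) (φ := fun _ : Fin N => ℝ) i).comp
      ((ContinuousLinearMap.fst ℝ (Fin N → ℝ) ℝ).comp
        (ContinuousLinearMap.snd ℝ (Fin N → ℝ) ((Fin N → ℝ) × ℝ)))).prod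
    ((ContinuousLinearMap.snd ℝ (Fin N → ℝ) ℝ).comp
      (ContinuousLinearMap.snd ℝ (Fin N → ℝ) ((Fin N → ℝ) × ℝ)))).hasStrictFDerivAt (x := W)
  exact h1.mul ((hasStrictFDerivAt_eval_heat p (W.2.1 i, W.2.2)).comp W h2)

lemma paramEvalDeriv_eq_zero {W : Params N} {p : ℝ[X]}
    (h0 : ∀ i, (heat W.2.2 p).eval (W.2.1 i) = 0)
    (h1 : ∀ i, (derivative (heat W.2.2 p)).eval (W.2.1 i) = 0)
    (h2 : ∑ i, W.1 i * (derivative (derivative (heat W.2.2 p))).eval (W.2.1 i) = 0) :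
    paramEvalDeriv W p = 0 := by
  refine ContinuousLinearMap.ext fun d => ?_
  rw [paramEvalDeriv_apply]
  simp only [h0, h1, zero_mul, zero_add, ← mul_assoc, ← Finset.sum_mul, h2]
  simp

/-- Variations of the weights detect the values at the nodes, variations of the nodes the first
derivatives, and a variation of the variance the weighted sum of second derivatives. -/
lemma of_paramEvalDeriv_eq_zero {W : Params N} {p : ℝ[X]} (hw : ∀ i, W.1 i ≠ 0)
    (h : paramEvalDeriv W p = 0) :
    (∀ i, (heat W.2.2 p).eval (W.2.1 i) = 0) ∧
    (∀ i, (derivative (heat W.2.2 p)).eval (W.2.1 i) = 0) ∧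
    ∑ i, W.1 i * (derivative (derivative (heat W.2.2 p))).eval (W.2.1 i) = 0 := by
  have key : ∀ d, paramEvalDeriv W p d = 0 := fun d => by rw [h]; rfl
  simp only [paramEvalDeriv_apply] at key
  refine ⟨fun i => ?_, fun i => ?_, ?_⟩
  · simpa [Pi.single_apply] using key (Pi.single i 1, 0, 0)
  · simpa [Pi.single_apply, hw i] using key (0, Pi.single i 1, 0)
  -- The component `2` cancels the factor `1 / 2` of the heat equation.
  · have := key (0, 0, 2)
    simpa using this

lemma eval_double_root (a : ℝ) (E K : ℝ[X]) :
    (((X - C a) * E) ^ 2 * K).eval a = 0 ∧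
    (derivative (((X - C a) * E) ^ 2 * K)).eval a = 0 ∧
    (derivative (derivative (((X - C a) * E) ^ 2 * K))).eval a = 2 * (E.eval a ^ 2 * K.eval a) := by
  simp [derivative_pow]
  ring

/-- The numbers `∏ j ≠ i, (u_i - u_j)²`. -/
def nodeGap (u : Fin N → ℝ) (i : Fin N) : ℝ :=
  (Lagrange.nodal (Finset.univ.erase i) u).eval (u i) ^ 2

lemma nodeGap_pos {u : Fin N → ℝ} (hu : ∀ i j, i ≠ j → u i ≠ u j) (i : Fin N) :
    0 < nodeGap u i := by
  refine sq_pos_of_ne_zero ?_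
  rw [Lagrange.eval_nodal, Finset.prod_ne_zero_iff]
  intro j hj
  exact sub_ne_zero.mpr (hu i j (Finset.ne_of_mem_erase hj).symm)

lemma eval_nodePoly_sq_mul (u : Fin N → ℝ) (K : ℝ[X]) (i : Fin N) :
    (nodePoly u ^ 2 * K).eval (u i) = 0 ∧
    (derivative (nodePoly u ^ 2 * K)).eval (u i) = 0 ∧
    (derivative (derivative (nodePoly u ^ 2 * K))).eval (u i) =
      2 * (nodeGap u i * K.eval (u i)) := by
  rw [nodePoly, Lagrange.nodal_eq_mul_nodal_erase (Finset.mem_univ i)]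
  exact eval_double_root _ _ _

lemma nodePoly_sq_dvd {u : Fin N → ℝ} (hu : ∀ i j, i ≠ j → u i ≠ u j) {G : ℝ[X]}
    (h0 : ∀ i, G.eval (u i) = 0) (h1 : ∀ i, (derivative G).eval (u i) = 0) :
    nodePoly u ^ 2 ∣ G := by
  rw [nodePoly, Lagrange.nodal, ← Finset.prod_pow]
  refine Finset.prod_dvd_of_coprime (fun i _ j _ hij => ?_) fun i _ => ?_
  · exact (pairwise_coprime_X_sub_C (s := u) (fun a b hab => by_contra fun h => hu a b h hab)
      hij).pow
  · obtain ⟨K, hK⟩ := dvd_iff_isRoot.mpr (h0 i)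
    have h := h1 i
    rw [hK] at h
    simp at h
    obtain ⟨K', hK'⟩ := dvd_iff_isRoot.mpr h
    exact ⟨K', by rw [hK, hK']; ring⟩

/-- Vanishing weight and node variations give double roots at all nodes, so `heat σ² p` is a
constant times `∏ (X - u_i)²` by degree. The variance variation multiplies this constant by a
strictly positive sum, so it vanishes. -/
lemma eq_zero_of_paramEvalDeriv_eq_zero [NeZero N] {W : Params N} (hW : W ∈ domainOpen N)
    {p : ℝ[X]} (hp : p.natDegree ≤ 2 * N) (h : paramEvalDeriv W p = 0) : p = 0 := by
  obtain ⟨h0, h1, h2⟩ := of_paramEvalDeriv_eq_zero (fun i => (hW.1 i).ne') h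
  obtain ⟨K, hK⟩ := nodePoly_sq_dvd hW.2.2 h0 h1
  have hheat : heat W.2.2 p = 0 := by
    by_contra hne
    have hK0 : K ≠ 0 := fun h => hne (by rw [hK, h, mul_zero])
    have hd : K.natDegree = 0 := by
      have := natDegree_heat_le W.2.2 p
      rw [hK, natDegree_mul (pow_ne_zero _ Lagrange.nodal_ne_zero) hK0,
        natDegree_nodePoly_sq] at this
      omega
    obtain ⟨c, rfl⟩ := natDegree_eq_zero.mp hd
    rw [hK] at h2
    simp only [(eval_nodePoly_sq_mul W.2.1 (C c) _).2.2, eval_C] at h2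
    have hpos : 0 < ∑ i, W.1 i * (2 * nodeGap W.2.1 i) :=
      Finset.sum_pos (fun i _ => mul_pos (hW.1 i) (mul_pos two_pos (nodeGap_pos hW.2.2 i)))
        Finset.univ_nonempty
    have : (∑ i, W.1 i * (2 * nodeGap W.2.1 i)) * c = 0 := by
      rw [← h2, Finset.sum_mul]
      exact Finset.sum_congr rfl fun i _ => by ring
    rcases mul_eq_zero.mp this with h | h
    · exact hpos.ne' h
    · exact hK0 (by rw [h, C_0])
  rw [← heat_neg_heat W.2.2 p, hheat, map_zero]

/-- The total derivative of the moment map. -/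
def momentDeriv (W : Params N) : Params N →L[ℝ] Moments N :=
  ContinuousLinearMap.pi fun j => paramEvalDeriv W (X ^ (j : ℕ))

lemma hasStrictFDerivAt_momentMap {W : Params N} (hv : 0 < W.2.2) :
    HasStrictFDerivAt (momentMap N) (momentDeriv W) W := by
  refine (hasStrictFDerivAt_pi.mpr fun j : Fin (2 * N + 1) =>
    hasStrictFDerivAt_paramEval (X ^ (j : ℕ)) W).congr_of_eventuallyEq ?_
  have : ∀ᶠ V : Params N in 𝓝 W, 0 < V.2.2 :=
    (continuous_snd.comp continuous_snd).continuousAt.eventually (lt_mem_nhds hv)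
  filter_upwards [this] with V hV
  ext j
  exact (paramMoment_eq_paramEval _ hV).symm

/-- A functional on moment vectors is a polynomial of degree at most `2N`; if it annihilates the
range, that polynomial has zero first variation and hence vanishes. -/
lemma momentDeriv_surjective [NeZero N] {W : Params N} (hW : W ∈ domainOpen N) :
    Function.Surjective (momentDeriv W) := by
  have hinj : Function.Injective
      (LinearMap.dualMap (momentDeriv W : Params N →ₗ[ℝ] Moments N)) := by
    refine (injective_iff_map_eq_zero _).mpr fun φ hφ => ?_
    set p : ℝ[X] := ∑ j : Fin (2 * N + 1), C (φ (Pi.single j 1)) * X ^ (j : ℕ) with hp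
    have hcoeff : ∀ j : Fin (2 * N + 1), p.coeff j = φ (Pi.single j 1) := by
      intro j
      simp [hp, coeff_X_pow, Fin.val_inj]
    have hφ' : ∀ M, φ M = ∑ j, φ (Pi.single j 1) * M j := by
      intro M
      conv_lhs => rw [pi_eq_sum_univ' M]
      simp only [map_sum, map_smul, smul_eq_mul]
      exact Finset.sum_congr rfl fun j _ => mul_comm _ _
    have h0 : paramEvalDeriv W p = 0 := by
      refine ContinuousLinearMap.ext fun d => ?_
      have := LinearMap.congr_fun hφ d
      rw [LinearMap.dualMap_apply, hφ'] at this
      simpa [hp, ← smul_eq_C_mul, momentDeriv] using this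
    have hdeg : p.natDegree ≤ 2 * N :=
      natDegree_sum_le_of_forall_le _ _ fun j _ =>
        (natDegree_C_mul_X_pow_le _ _).trans (Nat.lt_succ_iff.mp j.2)
    have hzero := eq_zero_of_paramEvalDeriv_eq_zero hW hdeg h0
    refine LinearMap.ext fun M => ?_
    rw [hφ']
    simp [← hcoeff, hzero]
  exact LinearMap.dualMap_injective_iff.mp hinj

/-- The derivative of the moment map as an equivalence, at distinct nodes. -/
def momentDerivEquiv [NeZero N] {W : Params N} (hW : W ∈ domainOpen N) :
    Params N ≃L[ℝ] Moments N :=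
  (LinearEquiv.ofBijective (momentDeriv W : Params N →ₗ[ℝ] Moments N)
    ⟨(LinearMap.injective_iff_surjective_of_finrank_eq_finrank (by simp; ring)).mpr
      (momentDeriv_surjective hW), momentDeriv_surjective hW⟩).toContinuousLinearEquiv

lemma hasStrictFDerivAt_momentMap_equiv [NeZero N] {W : Params N} (hW : W ∈ domainOpen N) :
    HasStrictFDerivAt (momentMap N) (momentDerivEquiv hW : Params N →L[ℝ] Moments N) W :=
  hasStrictFDerivAt_momentMap hW.2.1

lemma isOpen_domainOpen : IsOpen (domainOpen N) := by
  have h : domainOpen N = (⋂ i, {W : Params N | 0 < W.1 i}) ∩ ({W | 0 < W.2.2} ∩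
      ⋂ i, ⋂ j, ⋂ (_ : i ≠ j), {W : Params N | W.2.1 i ≠ W.2.1 j}) := by
    ext W
    simp [domainOpen]
  rw [h]
  refine (isOpen_iInter_of_finite fun i => ?_).inter (IsOpen.inter ?_
    (isOpen_iInter_of_finite fun i => isOpen_iInter_of_finite fun j =>
      isOpen_iInter_of_finite fun _ => ?_))
  · exact isOpen_lt (by fun_prop) (by fun_prop)
  · exact isOpen_lt (by fun_prop) (by fun_prop)
  · exact isOpen_ne_fun (by fun_prop) (by fun_prop)

theorem isOpen_momentMap_image [NeZero N] : IsOpen (momentMap N '' domainOpen N) := by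
  rw [isOpen_iff_mem_nhds]
  rintro _ ⟨W, hW, rfl⟩
  rw [← (hasStrictFDerivAt_momentMap_equiv hW).map_nhds_eq_of_equiv]
  exact image_mem_map (isOpen_domainOpen.mem_nhds hW)

/-- Near `momentMap N W` the inverse function theorem supplies parameters with distinct nodes, so
the closing moment is the moment of order `2N + 1` composed with the local inverse. -/
lemma hasFDerivAt_closingMoment [NeZero N] {W : Params N} (hW : W ∈ domainOpen N)
    {a : Moments N →L[ℝ] ℝ}
    (ha : paramEvalDeriv W (X ^ (2 * N + 1)) = a.comp (momentDeriv W)) :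
    HasFDerivAt (closingMoment N) a (momentMap N W) := by
  have hf := hasStrictFDerivAt_momentMap_equiv hW
  have hinv := hf.to_localInverse.hasFDerivAt
  have hcont := hinv.continuousAt
  have hW0 : hf.localInverse _ _ _ (momentMap N W) = W := hf.localInverse_apply_image
  rw [ContinuousAt, hW0] at hcont
  have h1 : HasFDerivAt (paramEval (X ^ (2 * N + 1)) ∘ hf.localInverse _ _ _) _ (momentMap N W) :=
    HasFDerivAt.comp _ (hW0.symm ▸ (hasStrictFDerivAt_paramEval (X ^ (2 * N + 1)) W).hasFDerivAt)
      hinv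
  rw [hW0] at h1
  refine (h1.congr_of_eventuallyEq ?_).congr_fderiv ?_
  · filter_upwards [hf.eventually_right_inverse, hcont (isOpen_domainOpen.mem_nhds hW)]
      with M hM1 hM2
    have hdom : hf.localInverse _ _ _ M ∈ domain N := Or.inl hM2
    conv_lhs => rw [← hM1]
    rw [closingMoment_momentMap hdom, paramMoment_eq_paramEval _ (variance_pos_of_mem_domain hdom)]
    rfl
  · rw [ha]
    refine ContinuousLinearMap.ext fun M => ?_
    exact congrArg a ((momentDerivEquiv hW).apply_symm_apply M)

end EQMOM
end

noncomputable section
/-! ## The coefficients of the closure -/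

namespace EQMOM

open Polynomial

variable {N : ℕ}

/-- The polynomial `(X - α) ∏ i, (X - u_i)²`. -/
def doublePoly (u : Fin N → ℝ) (α : ℝ) : ℝ[X] := nodePoly u ^ 2 * (X - C α)

/-- The simple node: the mean of the nodes with the weights `w_i ∏ j ≠ i, (u_i - u_j)²`. -/
def simpleNode (W : Params N) : ℝ :=
  Finset.univ.centerMass (fun i => W.1 i * nodeGap W.2.1 i) W.2.1

/-- The characteristic polynomial of the coefficient matrix, with the simple node `α`. -/
def charPoly (W : Params N) (α : ℝ) : ℝ[X] := heat (-W.2.2) (doublePoly W.2.1 α)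

lemma exists_roots_charPoly {W : Params N} (hv : 0 < W.2.2) (α : ℝ) :
    ∃ ev : Fin (2 * N + 1) → ℝ, StrictMono ev ∧ charPoly W α = nodePoly ev := by
  have h := exists_roots_heat_neg hv (List.ofFn W.2.1 ++ List.ofFn W.2.1 ++ [α])
  have hlen : (List.ofFn W.2.1 ++ List.ofFn W.2.1 ++ [α]).length = 2 * N + 1 := by
    simp
    ring
  rw [hlen] at h
  have e : (List.map (fun r => X - C r) (List.ofFn W.2.1 ++ List.ofFn W.2.1 ++ [α])).prod =
      doublePoly W.2.1 α := by
    simp [doublePoly, nodePoly, Lagrange.nodal, List.prod_ofFn, List.map_ofFn, sq, mul_assoc]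
  rwa [e] at h

lemma X_pow_eq_charPoly_sub {W : Params N} (hv : 0 < W.2.2) (α : ℝ) :
    (X : ℝ[X]) ^ (2 * N + 1) = charPoly W α -
      ∑ j : Fin (2 * N + 1), C ((charPoly W α).coeff j) * X ^ (j : ℕ) := by
  obtain ⟨ev, -, h⟩ := exists_roots_charPoly hv α
  have hm : (charPoly W α).Monic := h ▸ Lagrange.nodal_monic
  have hd : (charPoly W α).natDegree = 2 * N + 1 := by simp [h, nodePoly, Lagrange.natDegree_nodal]
  have := hm.as_sum
  rw [hd, Finset.sum_range] at this
  rw [eq_sub_iff_add_eq]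
  exact this.symm

/-- Undoing the flow leaves double roots at all nodes, which kill the weight and node variations.
The simple node is exactly the mean that makes the weighted sum of second derivatives vanish. -/
lemma paramEvalDeriv_charPoly [NeZero N] {W : Params N} (hW : W ∈ domainOpen N) :
    paramEvalDeriv W (charPoly W (simpleNode W)) = 0 := by
  have h := eval_nodePoly_sq_mul W.2.1 (X - C (simpleNode W))
  rw [← doublePoly] at h
  refine paramEvalDeriv_eq_zero ?_ ?_ ?_ <;> simp only [charPoly, heat_heat_neg]
  · exact fun i => (h i).1
  · exact fun i => (h i).2.1
  · have hpos : 0 < ∑ i, W.1 i * nodeGap W.2.1 i :=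
      Finset.sum_pos (fun i _ => mul_pos (hW.1 i) (nodeGap_pos hW.2.2 i)) Finset.univ_nonempty
    have hα : (∑ i, W.1 i * nodeGap W.2.1 i) * simpleNode W =
        ∑ i, W.1 i * nodeGap W.2.1 i * W.2.1 i := by
      simp only [simpleNode, Finset.centerMass, smul_eq_mul]
      exact mul_inv_cancel_left₀ hpos.ne' _
    calc _ = 2 * (∑ i, W.1 i * nodeGap W.2.1 i * W.2.1 i -
          (∑ i, W.1 i * nodeGap W.2.1 i) * simpleNode W) := by
          rw [Finset.sum_mul, ← Finset.sum_sub_distrib, Finset.mul_sum]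
          refine Finset.sum_congr rfl fun i _ => ?_
          rw [(h i).2.2]
          simp
          ring
      _ = 0 := by rw [hα, sub_self, mul_zero]

/-- To first order the characteristic polynomial integrates to zero, so its leading power `X ^ (2N +
1)` can be exchanged for minus its lower-order part. -/
lemma hasFDerivAt_closingMoment_charPoly [NeZero N] {W : Params N} (hW : W ∈ domainOpen N) :
    HasFDerivAt (closingMoment N)
      (-∑ j : Fin (2 * N + 1), (charPoly W (simpleNode W)).coeff j •
        ContinuousLinearMap.proj (R := ℝ) (φ := fun _ : Fin (2 * N + 1) => ℝ) j)
      (momentMap N W) := by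
  refine hasFDerivAt_closingMoment hW ?_
  rw [X_pow_eq_charPoly_sub hW.2.1 (simpleNode W), map_sub, paramEvalDeriv_charPoly hW]
  refine ContinuousLinearMap.ext fun d => ?_
  simp [← smul_eq_C_mul, momentDeriv]

lemma closingGradient_momentMap [NeZero N] {W : Params N} (hW : W ∈ domainOpen N) :
    closingGradient N (momentMap N W) = fun j : Fin (2 * N + 1) =>
      -(charPoly W (simpleNode W)).coeff j := by
  ext j
  rw [closingGradient, (hasFDerivAt_closingMoment_charPoly hW).fderiv]
  simp [Pi.single_apply]

/-- Each new coefficient is a polynomial in `v`, `r` and the coefficients of `heat v q`, so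
convergence passes through one linear factor at a time. -/
lemma tendsto_coeff_heat_mul {ι : Type*} {l : Filter ι} {v r : ι → ℝ} {q : ι → ℝ[X]}
    {v₀ r₀ : ℝ} {q₀ : ℝ[X]} (hv : Tendsto v l (𝓝 v₀)) (hr : Tendsto r l (𝓝 r₀))
    (hq : ∀ j, Tendsto (fun t => (heat (v t) (q t)).coeff j) l (𝓝 ((heat v₀ q₀).coeff j)))
    (j : ℕ) : Tendsto (fun t => (heat (v t) ((X - C (r t)) * q t)).coeff j) l
      (𝓝 ((heat v₀ ((X - C r₀) * q₀)).coeff j)) := by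
  have h0 : ∀ j v r q, (heat v ((X - C r) * q)).coeff j =
      (X * heat v q).coeff j - r * (heat v q).coeff j +
        v * ((heat v q).coeff (j + 1) * (j + 1)) := by
    intro j v r q
    rw [heat_X_sub_C_mul, coeff_add, sub_mul, coeff_sub, coeff_C_mul, coeff_C_mul, coeff_derivative]
  simp only [h0]
  refine Tendsto.add (Tendsto.sub ?_ (hr.mul (hq j))) (hv.mul ((hq (j + 1)).mul_const _))
  cases j with
  | zero => simpa using tendsto_const_nhds
  | succ j => simpa using hq j

lemma tendsto_coeff_charPoly {ι : Type*} {l : Filter ι} {V : ι → Params N} {α : ι → ℝ}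
    {W : Params N} {β : ℝ} (hV : Tendsto V l (𝓝 W)) (hα : Tendsto α l (𝓝 β)) (j : ℕ) :
    Tendsto (fun t => (charPoly (V t) (α t)).coeff j) l (𝓝 ((charPoly W β).coeff j)) := by
  have hv : Tendsto (fun t => -(V t).2.2) l (𝓝 (-W.2.2)) :=
    ((continuous_snd.comp continuous_snd).continuousAt.tendsto.comp hV).neg
  have hu : ∀ i, Tendsto (fun t => (V t).2.1 i) l (𝓝 (W.2.1 i)) := fun i =>
    (((continuous_apply i).comp (continuous_fst.comp continuous_snd)).continuousAt.tendsto.comp hV)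
  have key : ∀ (s : Finset (Fin N)) (j : ℕ), Tendsto
      (fun t => (heat (-(V t).2.2)
        ((∏ i ∈ s, (X - C ((V t).2.1 i))) ^ 2 * (X - C (α t)))).coeff j) l
      (𝓝 ((heat (-W.2.2) ((∏ i ∈ s, (X - C (W.2.1 i))) ^ 2 * (X - C β))).coeff j)) := by
    intro s
    induction s using Finset.induction_on with
    | empty =>
      have := tendsto_coeff_heat_mul (q := fun _ => 1) (q₀ := 1) hv hα
        (fun j => by simpa using tendsto_const_nhds)
      simpa using this
    | insert i s hi ih =>
      have e : ∀ a p q : ℝ[X], (a * p) ^ 2 * q = a * (a * (p ^ 2 * q)) := fun a p q => by ring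
      simp only [Finset.prod_insert hi, e]
      exact tendsto_coeff_heat_mul hv (hu i) (tendsto_coeff_heat_mul hv (hu i) ih)
  exact key Finset.univ j

/-- The averaging weights may degenerate as the nodes merge, but a convex combination of points in a
ball stays in the ball, so no control of them is needed. -/
lemma tendsto_simpleNode [NeZero N] {W : Params N} {U : ℝ} (hU : ∀ i, W.2.1 i = U) :
    Tendsto simpleNode (𝓝[domainOpen N] W) (𝓝 U) := by
  rw [Metric.tendsto_nhds]
  intro ε hε
  have hu : ∀ᶠ V : Params N in 𝓝 W, ∀ i, V.2.1 i ∈ Metric.ball U ε := by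
    refine eventually_all.mpr fun i => ?_
    have : Tendsto (fun V : Params N => V.2.1 i) (𝓝 W) (𝓝 U) := by
      rw [← hU i]
      exact ((continuous_apply i).comp (continuous_fst.comp continuous_snd)).continuousAt
    exact this (Metric.ball_mem_nhds U hε)
  filter_upwards [hu.filter_mono nhdsWithin_le_nhds, self_mem_nhdsWithin] with V hV hdom
  have hpos : ∀ i, 0 < V.1 i * nodeGap V.2.1 i := fun i =>
    mul_pos (hdom.1 i) (nodeGap_pos hdom.2.2 i)
  exact (convex_ball U ε).centerMass_mem (fun i _ => (hpos i).le)
    (Finset.sum_pos (fun i _ => hpos i) Finset.univ_nonempty) fun i _ => hV i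

lemma tendsto_closingGradient [NeZero N] {W : Params N} {U : ℝ} (hU : ∀ i, W.2.1 i = U) :
    Tendsto (fun V => closingGradient N (momentMap N V)) (𝓝[domainOpen N] W)
      (𝓝 fun j : Fin (2 * N + 1) => -(charPoly W U).coeff j) := by
  refine tendsto_pi_nhds.mpr fun j => ?_
  refine ((tendsto_coeff_charPoly (V := id) (tendsto_id'.mpr nhdsWithin_le_nhds)
    (tendsto_simpleNode hU) (j : ℕ)).neg).congr' ?_
  filter_upwards [self_mem_nhdsWithin] with V hV
  rw [closingGradient_momentMap hV]
  rfl

/-- Equal nodes are separated by moving the `i`-th one by `ε i`. -/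
lemma neBot_nhdsWithin_domainOpen {W : Params N} (hW : W ∈ domainEq N) :
    (𝓝[domainOpen N] W).NeBot := by
  have hlim : Tendsto (fun ε : ℝ => ((W.1, (fun i : Fin N => W.2.1 i + ε * (i : ℕ)), W.2.2) :
      Params N)) (𝓝[>] 0) (𝓝 W) := by
    have hc : Continuous (fun ε : ℝ => ((W.1, (fun i : Fin N => W.2.1 i + ε * (i : ℕ)), W.2.2) :
      Params N)) := by fun_prop
    have := hc.tendsto 0
    simp only [zero_mul, add_zero] at this
    exact this.mono_left nhdsWithin_le_nhds
  refine NeBot.mono (NeBot.map (f := 𝓝[>] (0 : ℝ)) inferInstance _) (tendsto_nhdsWithin_iff.mpr ⟨hlim, ?_⟩)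
  filter_upwards [self_mem_nhdsWithin] with ε hε
  refine ⟨hW.1, hW.2.1, fun i j hij h => hij (Fin.ext ?_)⟩
  simp only [hW.2.2 i j, add_right_inj] at h
  exact_mod_cast mul_left_cancel₀ (ne_of_gt hε) h

end EQMOM
end

noncomputable section
/-! ## Macroscopic parameters and equilibria -/

namespace EQMOM

open Polynomial

variable {N : ℕ}

lemma comp_momentMap {W : Params N} (hv : 0 < W.2.2) {j : ℕ} (hj : j < 2 * N + 1) :
    comp (momentMap N W) j = paramEval (X ^ j) W := by
  rw [comp, dif_pos hj, momentMap, paramMoment_eq_paramEval _ hv]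

lemma density_momentMap {W : Params N} (hv : 0 < W.2.2) :
    density (momentMap N W) = ∑ i, W.1 i := by
  rw [density, comp_momentMap hv (by omega)]
  simp [paramEval]

lemma density_pos [NeZero N] {W : Params N} (hW : W ∈ domain N) :
    0 < density (momentMap N W) := by
  rw [density_momentMap (variance_pos_of_mem_domain hW)]
  exact Finset.sum_pos (fun i _ => weight_pos_of_mem_domain hW i) Finset.univ_nonempty

/-- Integrating `(X - U)²` against the mixture gives `ρ θ`, and each Gaussian contributes a positive
amount. -/
lemma temperature_pos [NeZero N] {W : Params N} (hW : W ∈ domain N) :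
    0 < temperature (momentMap N W) := by
  have hv := variance_pos_of_mem_domain hW
  have hN : N ≠ 0 := NeZero.ne N
  have hρ := density_pos hW
  have h0 : paramEval 1 W = density (momentMap N W) := by
    rw [density, comp_momentMap hv (by omega), pow_zero]
  have h1 : paramEval X W = comp (momentMap N W) 1 := by
    rw [comp_momentMap hv (by omega), pow_one]
  have h2 := comp_momentMap hv (j := 2) (by omega)
  have hlin : ∀ a b c : ℝ, paramEval (C a * X ^ 2 + C b * X + C c) W =
      a * paramEval (X ^ 2) W + b * paramEval X W + c * paramEval 1 W := by
    intro a b c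
    simp only [paramEval, map_add, heat_C_mul, heat_C, eval_add, eval_mul, eval_C, Finset.mul_sum,
      ← Finset.sum_add_distrib, heat_one, eval_one]
    exact Finset.sum_congr rfl fun i _ => by ring
  have hpos : 0 < paramEval ((X - C (velocity (momentMap N W))) ^ 2) W :=
    Finset.sum_pos (fun i _ => mul_pos (weight_pos_of_mem_domain hW i)
      (eval_heat_sq_pos (X_sub_C_ne_zero _) hv _)) Finset.univ_nonempty
  have e : (X - C (velocity (momentMap N W))) ^ 2 =
      C 1 * X ^ 2 + C (-2 * velocity (momentMap N W)) * X + C (velocity (momentMap N W) ^ 2) := by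
    simp only [C_1, C_mul, C_neg, C_pow, C_ofNat]
    ring
  rw [e, hlin, h0, h1, ← h2, velocity] at hpos
  have : temperature (momentMap N W) = (1 * comp (momentMap N W) 2 +
      -2 * (comp (momentMap N W) 1 / density (momentMap N W)) * comp (momentMap N W) 1 +
      (comp (momentMap N W) 1 / density (momentMap N W)) ^ 2 * density (momentMap N W)) /
      density (momentMap N W) := by
    rw [temperature, velocity]
    field_simp
    ring
  rw [this]
  exact div_pos hpos hρ

lemma gaussMoment_zero {v : ℝ} (hv : 0 < v) (u : ℝ) : gaussMoment 0 u v = 1 := by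
  simp [gaussMoment_eq hv]

lemma gaussMoment_one {v : ℝ} (hv : 0 < v) (u : ℝ) : gaussMoment 1 u v = u := by
  have := heat_X_mul v 1
  simp only [mul_one, heat_one, derivative_one, mul_zero, add_zero] at this
  simp [gaussMoment_eq hv, this]

lemma gaussMoment_succ_succ {v : ℝ} (hv : 0 < v) (u : ℝ) (j : ℕ) :
    gaussMoment (j + 2) u v = u * gaussMoment (j + 1) u v + v * (j + 1) * gaussMoment j u v := by
  simp only [gaussMoment_eq hv]
  rw [pow_succ' X (j + 1), heat_X_mul, derivative_heat_X_pow_succ]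
  simp
  ring

lemma gaussMoment_two {v : ℝ} (hv : 0 < v) (u : ℝ) : gaussMoment 2 u v = u ^ 2 + v := by
  have := gaussMoment_succ_succ hv u 0
  rw [this, gaussMoment_one hv, gaussMoment_zero hv]
  simp
  ring

lemma gaussMoment_three {v : ℝ} (hv : 0 < v) (u : ℝ) :
    gaussMoment 3 u v = u ^ 3 + 3 * u * v := by
  have := gaussMoment_succ_succ hv u 1
  rw [this, gaussMoment_two hv, gaussMoment_one hv]
  norm_num
  ring

lemma momentMap_of_const {W : Params N} {u : ℝ} (hu : ∀ i, W.2.1 i = u) (j : Fin (2 * N + 1)) :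
    momentMap N W j = (∑ i, W.1 i) * gaussMoment j u W.2.2 := by
  simp [momentMap, paramMoment, hu, Finset.sum_mul]

lemma velocity_and_temperature_of_const [NeZero N] {W : Params N} (hW : W ∈ domain N) {u : ℝ}
    (hu : ∀ i, W.2.1 i = u) :
    velocity (momentMap N W) = u ∧ temperature (momentMap N W) = W.2.2 := by
  have hv := variance_pos_of_mem_domain hW
  have hN : N ≠ 0 := NeZero.ne N
  have hρ := density_pos hW
  have h1 : comp (momentMap N W) 1 = density (momentMap N W) * u := by
    rw [comp, dif_pos (by omega), momentMap_of_const hu, density_momentMap hv, gaussMoment_one hv]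
  have h2 : comp (momentMap N W) 2 = density (momentMap N W) * (u ^ 2 + W.2.2) := by
    rw [comp, dif_pos (by omega), momentMap_of_const hu, density_momentMap hv, gaussMoment_two hv]
  have hU : velocity (momentMap N W) = u := by
    rw [velocity, h1]
    field_simp
  refine ⟨hU, ?_⟩
  rw [temperature, hU, h2]
  field_simp
  ring

lemma velocity_and_temperature_of_mem_domainEq [NeZero N] {W : Params N} (hW : W ∈ domainEq N) :
    (∀ i, W.2.1 i = velocity (momentMap N W)) ∧ W.2.2 = temperature (momentMap N W) := by
  have h := velocity_and_temperature_of_const (Or.inr hW) (u := W.2.1 0) fun i => hW.2.2 i 0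
  exact ⟨fun i => by rw [h.1]; exact hW.2.2 i 0, h.2.symm⟩

/-- If the source vanishes, the moments are those of the equal-node parameter with weights `ρ / N`,
nodes `U` and variance `θ`, which distinct nodes cannot reproduce. -/
theorem bgkSource_eq_zero_iff (hN : 2 ≤ N) {W : Params N} (hW : W ∈ domain N) :
    bgkSource N (momentMap N W) = 0 ↔ W ∈ domainEq N := by
  have : NeZero N := ⟨by omega⟩
  refine ⟨fun h => ?_, fun h => ?_⟩
  · refine hW.elim (fun hopen => ?_) id
    have hρ := density_pos hW
    set V : Params N := (fun _ => density (momentMap N W) / N,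
      fun _ => velocity (momentMap N W), temperature (momentMap N W)) with hV
    have hVeq : V ∈ domainEq N := ⟨fun _ => by positivity, temperature_pos hW, fun _ _ => rfl⟩
    refine absurd ?_ (momentMap_ne_of_mem hN hopen hVeq)
    rw [← sub_eq_zero.mp h]
    ext j
    rw [momentMap_of_const (u := velocity (momentMap N W)) (fun _ => rfl)]
    have hN0 : (N : ℝ) ≠ 0 := NeZero.ne _
    simp [hV, equilibriumMoments, mul_div_cancel₀ _ hN0]
  · obtain ⟨h1, h2⟩ := velocity_and_temperature_of_mem_domainEq h
    rw [bgkSource, sub_eq_zero]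
    ext j
    rw [equilibriumMoments, ← h2, density_momentMap h.2.1, momentMap_of_const h1]

/-- The vector `(binom(j, 3) Δ_{j-3}(U, θ))_j`. -/
def heatFluxVector (N : ℕ) (M : Moments N) : Moments N :=
  fun j => (Nat.choose (j : ℕ) 3 : ℝ) * gaussMoment ((j : ℕ) - 3) (velocity M) (temperature M)

/-- Stein's identity applied repeatedly: the cubic Hermite polynomial `(X - u)³ - 3 v (X - u)` acts
under the Gaussian as `v³` times a third derivative. -/
lemma eval_heat_hermite_three_mul (v u : ℝ) (p : ℝ[X]) :
    (heat v ((X - C u) * ((X - C u) * ((X - C u) * p)))).eval u =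
      3 * v * (heat v ((X - C u) * p)).eval u + v ^ 3 * (heat v (derivative^[3] p)).eval u := by
  simp only [eval_heat_X_sub_C_mul, derivative_mul, derivative_sub, derivative_X,
    derivative_C, sub_zero, one_mul, map_add, eval_add, Function.iterate_succ,
    Function.iterate_zero, Function.comp_apply, id]
  ring

/-- The correction is a multiple of the cubic Hermite polynomial, so only the third derivative of `ξ
^ j`, namely `6 binom(j, 3) ξ ^ (j - 3)`, survives. -/
lemma integral_shakhovDensity (Pr q U : ℝ) {ρ θ : ℝ} (hρ : ρ ≠ 0) (hθ : 0 < θ) (j : ℕ) :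
    ∫ ξ : ℝ, ξ ^ j * shakhovDensity Pr ρ U θ q ξ = ρ * gaussMoment j U θ +
      (1 - Pr) * (2 * q) * ((Nat.choose j 3 : ℝ) * gaussMoment (j - 3) U θ) := by
  set k := (1 - Pr) * q / (3 * ρ * θ ^ 2) with hk
  set p : ℝ[X] := C ρ * X ^ j + C (ρ * k / θ) * ((X - C U) * ((X - C U) * ((X - C U) * X ^ j))) -
    C (3 * ρ * k) * ((X - C U) * X ^ j) with hp
  have h1 : ∀ ξ : ℝ, ξ ^ j * shakhovDensity Pr ρ U θ q ξ = p.eval ξ * gaussDensity U θ ξ := by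
    intro ξ
    simp only [shakhovDensity, hp, hk, eval_add, eval_sub, eval_mul, eval_C, eval_pow, eval_X]
    field_simp
    ring
  simp_rw [h1]
  rw [integral_eval_mul_gaussDensity _ hθ, hp, map_sub, map_add, heat_C_mul, heat_C_mul, heat_C_mul,
    eval_sub, eval_add, eval_mul, eval_mul, eval_mul, eval_heat_hermite_three_mul,
    iterate_derivative_X_pow_eq_C_mul, heat_C_mul, eval_mul, Nat.descFactorial_eq_factorial_mul_choose,
    ← gaussMoment_eq hθ, ← gaussMoment_eq hθ]
  simp only [eval_C, hk, Nat.cast_mul, show (Nat.factorial 3 : ℕ) = 6 from rfl]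
  push_cast
  field_simp
  ring

lemma two_mul_heatFlux {M : Moments N} (hN : 2 ≤ N) (hθ : 0 < temperature M) :
    2 * heatFlux M = -bgkSource N M ⟨3, by omega⟩ := by
  rw [heatFlux, comp, dif_pos (by omega)]
  simp only [bgkSource, equilibriumMoments, Pi.sub_apply, gaussMoment_three hθ]
  ring

/-- Since `2 q = -S_3`, the Shakhov source is the BGK source plus a multiple of one vector, with a
coefficient proportional to the component `S_3`. -/
lemma shakhovSource_eq {M : Moments N} (hN : 2 ≤ N) (hρ : density M ≠ 0) (hθ : 0 < temperature M)
    (Pr : ℝ) : shakhovSource N Pr M =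
      bgkSource N M - ((1 - Pr) * bgkSource N M ⟨3, by omega⟩) • heatFluxVector N M := by
  ext j
  rw [shakhovSource, integral_shakhovDensity _ _ _ hρ hθ, two_mul_heatFlux hN hθ]
  simp only [heatFluxVector, bgkSource, equilibriumMoments, Pi.sub_apply, Pi.smul_apply,
    smul_eq_mul]
  ring

/-- The third component of the Shakhov source is `Pr S_3`; once it vanishes, the correction
disappears. -/
theorem shakhovSource_eq_zero_iff (hN : 2 ≤ N) {Pr : ℝ} (hPr : 0 < Pr) {W : Params N}
    (hW : W ∈ domain N) : shakhovSource N Pr (momentMap N W) = 0 ↔ W ∈ domainEq N := by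
  have : NeZero N := ⟨by omega⟩
  have hθ := temperature_pos hW
  rw [← bgkSource_eq_zero_iff hN hW, shakhovSource_eq hN (density_pos hW).ne' hθ]
  refine ⟨fun h => ?_, fun h => by simp [h]⟩
  have h3 := congrFun h ⟨3, by omega⟩
  simp only [heatFluxVector, Pi.sub_apply, Pi.smul_apply, smul_eq_mul, Nat.choose_self,
    Nat.sub_self, gaussMoment_zero hθ, Pi.zero_apply] at h3
  have h4 : Pr * bgkSource N (momentMap N W) ⟨3, by omega⟩ = 0 := by
    rw [← h3]
    push_cast
    ring
  rcases mul_eq_zero.mp h4 with h5 | h5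
  · exact absurd h5 hPr.ne'
  · simpa [h5] using h

/-! ## The coefficients on the whole state space -/

lemma charPoly_of_const {W : Params N} {u : ℝ} (hu : ∀ i, W.2.1 i = u) :
    charPoly W u = heat (-W.2.2) ((X - C u) ^ (2 * N + 1)) := by
  simp [charPoly, doublePoly, nodePoly, Lagrange.nodal, hu]
  ring_nf

lemma closingCoeff_of_mem_domainOpen [NeZero N] {W : Params N} (hW : W ∈ domainOpen N) :
    closingCoeff N (momentMap N W) = fun j : Fin (2 * N + 1) =>
      -(charPoly W (simpleNode W)).coeff j := by
  rw [closingCoeff, if_pos ⟨W, hW, rfl⟩, closingGradient_momentMap hW]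

/-- Several equal-node parameters can share the moments `M`, but at equal nodes the limiting
polynomial depends only on `U` and `θ`. Hence the limits at all of them coincide, and the supremum
of the filters has a single limit. -/
lemma closingCoeff_of_mem_domainEq (hN : 2 ≤ N) {W : Params N} (hW : W ∈ domainEq N) :
    closingCoeff N (momentMap N W) = fun j : Fin (2 * N + 1) =>
      -(charPoly W (velocity (momentMap N W))).coeff j := by
  have : NeZero N := ⟨by omega⟩
  have hnot : momentMap N W ∉ momentMap N '' domainOpen N := by
    rintro ⟨V, hV, h⟩
    exact momentMap_ne_of_mem hN hV hW h
  rw [closingCoeff, if_neg hnot]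
  have hne : (⨆ V ∈ {V | V ∈ domainEq N ∧ momentMap N V = momentMap N W},
      𝓝[domainOpen N] V).NeBot :=
    (neBot_nhdsWithin_domainOpen hW).mono
      (le_iSup₂_of_le W (show W ∈ domainEq N ∧ _ from ⟨hW, rfl⟩) le_rfl)
  refine Tendsto.limUnder_eq (tendsto_iSup.mpr fun V => tendsto_iSup.mpr fun hV => ?_)
  have h1 := velocity_and_temperature_of_mem_domainEq hV.1
  have h2 := velocity_and_temperature_of_mem_domainEq hW
  rw [hV.2] at h1
  have := tendsto_closingGradient h1.1
  rwa [charPoly_of_const h1.1, h1.2, ← h2.2, ← charPoly_of_const h2.1] at this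

/-- At every state the coefficients come from a characteristic polynomial with simple real roots. -/
lemma exists_closingCoeff_eq (hN : 2 ≤ N) {M : Moments N} (hM : M ∈ stateSpace N) :
    ∃ ev : Fin (2 * N + 1) → ℝ, StrictMono ev ∧
      closingCoeff N M = fun j : Fin (2 * N + 1) => -(nodePoly ev).coeff j := by
  have : NeZero N := ⟨by omega⟩
  obtain ⟨W, hW, rfl⟩ := hM
  rcases hW with hW | hW
  · obtain ⟨ev, hev, h⟩ := exists_roots_charPoly hW.2.1 (simpleNode W)
    exact ⟨ev, hev, by rw [closingCoeff_of_mem_domainOpen hW, h]⟩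
  · obtain ⟨ev, hev, h⟩ := exists_roots_charPoly hW.2.1 (velocity (momentMap N W))
    exact ⟨ev, hev, by rw [closingCoeff_of_mem_domainEq hN hW, h]⟩

end EQMOM
end

noncomputable section
/-! ## Left eigenvectors -/

namespace EQMOM

open Polynomial

/-- The polynomial `∏ k ≠ i, (X - λ_k)`. -/
abbrev eigenPoly {n : ℕ} (ev : Fin n → ℝ) (i : Fin n) : ℝ[X] :=
  Lagrange.nodal (Finset.univ.erase i) ev

/-- The matrix whose rows are the coefficients of the polynomials `∏ k ≠ i, (X - λ_k)`. -/
def eigenMatrix {n : ℕ} (ev : Fin n → ℝ) : Matrix (Fin n) (Fin n) ℝ :=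
  Matrix.of fun i j => (eigenPoly ev i).coeff j

section

variable {n : ℕ} {ev : Fin n → ℝ}

lemma X_sub_C_mul_eigenPoly (ev : Fin n → ℝ) (i : Fin n) :
    (X - C (ev i)) * eigenPoly ev i = nodePoly ev :=
  (Lagrange.nodal_eq_mul_nodal_erase (Finset.mem_univ i)).symm

lemma natDegree_eigenPoly (ev : Fin n → ℝ) (i : Fin n) : (eigenPoly ev i).natDegree = n - 1 := by
  rw [Lagrange.natDegree_nodal, Finset.card_erase_of_mem (Finset.mem_univ i), Finset.card_univ,
    Fintype.card_fin]

lemma coeff_eigenPoly_last (ev : Fin n → ℝ) (i : Fin n) : (eigenPoly ev i).coeff (n - 1) = 1 := by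
  rw [← natDegree_eigenPoly ev i]
  exact (Lagrange.nodal_monic (s := Finset.univ.erase i) (v := ev)).coeff_natDegree

lemma eigenPoly_eq_sum (ev : Fin n → ℝ) (i : Fin n) :
    eigenPoly ev i = ∑ j : Fin n, C ((eigenPoly ev i).coeff j) * X ^ (j : ℕ) := by
  rw [Fin.sum_univ_eq_sum_range (fun j => C ((eigenPoly ev i).coeff j) * X ^ j) n]
  refine as_sum_range_C_mul_X_pow' _ ?_
  rw [natDegree_eigenPoly]
  exact Nat.sub_lt i.pos one_pos

/-- Multiplying by the Vandermonde matrix evaluates the row polynomials at the roots, giving a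
diagonal matrix with nonzero entries. -/
lemma isUnit_eigenMatrix (hev : Function.Injective ev) : IsUnit (eigenMatrix ev) := by
  have h : eigenMatrix ev * Matrix.of (fun j k : Fin n => ev k ^ (j : ℕ)) =
      Matrix.diagonal fun i => (eigenPoly ev i).eval (ev i) := by
    ext i k
    have e : (eigenMatrix ev * Matrix.of (fun j k : Fin n => ev k ^ (j : ℕ))) i k =
        (eigenPoly ev i).eval (ev k) := by
      conv_rhs => rw [eigenPoly_eq_sum, eval_finsetSum]
      simp [Matrix.mul_apply, eigenMatrix]
    rw [e, Matrix.diagonal_apply]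
    split_ifs with hik
    · rw [hik]
    · exact Lagrange.eval_nodal_at_node (Finset.mem_erase.mpr ⟨fun h => hik h.symm,
        Finset.mem_univ k⟩)
  rw [Matrix.isUnit_iff_isUnit_det, isUnit_iff_ne_zero]
  intro hdet
  have := congrArg Matrix.det h
  rw [Matrix.det_mul, hdet, zero_mul, Matrix.det_diagonal, eq_comm, Finset.prod_eq_zero_iff] at this
  obtain ⟨i, -, hi⟩ := this
  rw [Lagrange.eval_nodal, Finset.prod_eq_zero_iff] at hi
  obtain ⟨j, hj, hij⟩ := hi
  exact Finset.ne_of_mem_erase hj (hev (sub_eq_zero.mp hij)).symm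

/-- Lagrange interpolation of `q`, coefficient by coefficient. -/
lemma sum_nodalWeight_mul_coeff_eigenPoly (hev : Function.Injective ev) {q : ℝ[X]}
    (hq : q.natDegree < n) (j : ℕ) :
    ∑ i, Lagrange.nodalWeight Finset.univ ev i * q.eval (ev i) * (eigenPoly ev i).coeff j =
      q.coeff j := by
  have hdeg : q.degree < (Finset.univ : Finset (Fin n)).card := by
    rw [Finset.card_univ, Fintype.card_fin]
    exact (degree_le_natDegree).trans_lt (by exact_mod_cast hq)
  have h := Lagrange.eq_interpolate (v := ev) hev.injOn hdeg
  conv_rhs => rw [h, Lagrange.interpolate_apply, finsetSum_coeff]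
  refine Finset.sum_congr rfl fun i hi => ?_
  rw [Lagrange.basis_eq_prod_sub_inv_mul_nodal_div hi, ← Lagrange.nodal_erase_eq_nodal_div hi,
    ← mul_assoc, ← C_mul, coeff_C_mul]
  ring

end

/-- On coefficient rows `A` acts as multiplication by `X` modulo the characteristic polynomial, and
`X - λ_i` times the row polynomial equals that polynomial. -/
lemma vecMul_eigenMatrix {N : ℕ} {M : Moments N} {ev : Fin (2 * N + 1) → ℝ}
    (h : closingCoeff N M = fun j : Fin (2 * N + 1) => -(nodePoly ev).coeff j)
    (i : Fin (2 * N + 1)) :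
    Matrix.vecMul (eigenMatrix ev i) (coeffMatrix N M) = ev i • eigenMatrix ev i := by
  have hlast : (eigenPoly ev i).coeff (2 * N) = 1 := coeff_eigenPoly_last ev i
  ext j
  rw [Matrix.vecMul, dotProduct, Fin.sum_univ_castSucc]
  have h1 : ∀ k : Fin (2 * N), coeffMatrix N M k.castSucc j =
      if (j : ℕ) = (k : ℕ) + 1 then 1 else 0 := by
    intro k
    simp [coeffMatrix, k.2.ne]
  have h2 : coeffMatrix N M (Fin.last (2 * N)) j = -(nodePoly ev).coeff j := by
    simp [coeffMatrix, h]
  simp only [h1, h2, mul_ite, mul_one, mul_zero]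
  rw [← X_sub_C_mul_eigenPoly ev i, sub_mul, coeff_sub, coeff_C_mul]
  simp only [eigenMatrix, Matrix.of_apply, Fin.val_last, hlast, Fin.val_castSucc, Pi.smul_apply,
    smul_eq_mul, one_mul]
  induction j using Fin.cases with
  | zero => simp
  | succ j =>
    rw [Finset.sum_eq_single j]
    · simp
    · intro k _ hk
      rw [if_neg]
      rw [Fin.val_succ]
      exact fun h => hk (Fin.ext (by omega))
    · simp

/-! ## Hermite polynomials and orthogonality at equilibrium -/

/-- The Hermite polynomials with mean `U` and variance `θ`. -/
def hermitePoly (U θ : ℝ) (m : ℕ) : ℝ[X] := heat (-θ) ((X - C U) ^ m)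

lemma hermitePoly_zero (U θ : ℝ) : hermitePoly U θ 0 = 1 := by
  simp [hermitePoly]

lemma derivative_hermitePoly (U θ : ℝ) (m : ℕ) :
    derivative (hermitePoly U θ m) = C (m : ℝ) * hermitePoly U θ (m - 1) := by
  rw [hermitePoly, derivative_heat, derivative_X_sub_C_pow, heat_C_mul, hermitePoly]

lemma hermitePoly_succ (U θ : ℝ) (m : ℕ) :
    hermitePoly U θ (m + 1) =
      (X - C U) * hermitePoly U θ m - C (θ * m) * hermitePoly U θ (m - 1) := by
  conv_lhs => rw [hermitePoly, pow_succ', heat_X_sub_C_mul, ← hermitePoly, derivative_hermitePoly]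
  rw [C_neg, C_mul]
  ring

lemma natDegree_hermitePoly_le (U θ : ℝ) (m : ℕ) : (hermitePoly U θ m).natDegree ≤ m :=
  (natDegree_heat_le _ _).trans (by simp)

section

variable {n : ℕ} {ev : Fin n → ℝ} {U θ : ℝ}

/-- The derivatives at `U` of the heat flow of `∏ k ≠ i, (X - λ_k)`. -/
def eigenJet (ev : Fin n → ℝ) (U θ : ℝ) (i : Fin n) (m : ℕ) : ℝ :=
  (derivative^[m] (heat θ (eigenPoly ev i))).eval U

/-- Applying the heat flow to `(X - λ_i) ∏_{k ≠ i} (X - λ_k) = hermitePoly` returns `(X - U) ^ n`,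
whose derivatives of order below `n` vanish at `U`. -/
lemma eigenJet_recurrence (h : nodePoly ev = hermitePoly U θ n) (i : Fin n) {m : ℕ} (hm : m < n) :
    θ * eigenJet ev U θ i (m + 1) =
      (ev i - U) * eigenJet ev U θ i m - m * eigenJet ev U θ i (m - 1) := by
  have h1 : (X - C (ev i)) * heat θ (eigenPoly ev i) + C θ * derivative (heat θ (eigenPoly ev i)) =
      (X - C U) ^ n := by
    rw [← heat_X_sub_C_mul, X_sub_C_mul_eigenPoly, h, hermitePoly, heat_heat_neg]
  have h2 := congrArg (fun p => (derivative^[m] p).eval U) h1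
  rw [mul_comm (X - C (ev i)), mul_sub, iterate_map_add, iterate_derivative_sub,
    iterate_derivative_mul_X, mul_comm _ (C (ev i)), iterate_derivative_C_mul,
    iterate_derivative_C_mul, iterate_derivative_X_sub_pow] at h2
  simp only [eval_add, eval_sub, eval_mul, eval_X, eval_C, eval_pow, sub_self,
    zero_pow (Nat.sub_ne_zero_of_lt hm), nsmul_eq_mul, mul_zero] at h2
  simp only [eigenJet, Function.iterate_succ_apply]
  simp at h2
  linarith

/-- After scaling by `θ ^ m` the jets satisfy the Hermite recurrence in the variable `λ_i`. -/
lemma eigenJet_eq (h : nodePoly ev = hermitePoly U θ n) (i : Fin n) (m : ℕ) (hm : m < n) :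
    θ ^ m * eigenJet ev U θ i m = eigenJet ev U θ i 0 * (hermitePoly U θ m).eval (ev i) := by
  induction m using Nat.strong_induction_on with
  | _ m ih =>
    rcases m with _ | m
    · simp [hermitePoly_zero]
    · have h1 := ih m (by omega) (by omega)
      have hrec := eigenJet_recurrence h i (m := m) (by omega)
      rw [hermitePoly_succ, pow_succ, mul_assoc, hrec]
      simp only [eval_sub, eval_mul, eval_X, eval_C]
      rcases m with _ | m
      · simp only [pow_zero, one_mul] at h1
        simp [hermitePoly_zero]
        ring
      · have h2 := ih m (by omega) (by omega)
        simp only [Nat.add_sub_cancel]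
        linear_combination (ev i - U) * h1 - θ * ((m + 1 : ℕ) : ℝ) * h2

lemma eigenJet_last (ev : Fin n → ℝ) (U θ : ℝ) (i : Fin n) :
    eigenJet ev U θ i (n - 1) = (n - 1).factorial := by
  have h0 : (derivative^[n - 1] (eigenPoly ev i)).natDegree = 0 := by
    have := natDegree_iterate_derivative (eigenPoly ev i) (n - 1)
    rw [natDegree_eigenPoly] at this
    omega
  rw [eigenJet, iterate_derivative_heat, eq_C_of_natDegree_eq_zero h0, heat_C, eval_C,
    coeff_iterate_derivative, zero_add, coeff_eigenPoly_last, Nat.descFactorial_self]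
  simp

/-- The top jet is `(n - 1)!`, because the row polynomial is monic of degree `n - 1`. Combined with
`H_n' = n H_{n-1}` at `λ_i`, this turns the zeroth jet into a fixed multiple of `1 / H_n'(λ_i)`, the
Lagrange weight. -/
lemma eigenJet_zero_eq (hθ : θ ≠ 0) (h : nodePoly ev = hermitePoly U θ n) (i : Fin n) :
    eigenJet ev U θ i 0 =
      θ ^ (n - 1) * n.factorial * Lagrange.nodalWeight Finset.univ ev i := by
  have hn : n - 1 < n := Nat.sub_lt i.pos one_pos
  have h1 := eigenJet_eq h i (n - 1) hn
  rw [eigenJet_last] at h1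
  have h2 : (derivative (nodePoly ev)).eval (ev i) =
      n * (hermitePoly U θ (n - 1)).eval (ev i) := by
    rw [h, derivative_hermitePoly]
    simp
  have h3 : (n : ℝ) * (n - 1).factorial = n.factorial := by
    exact_mod_cast Nat.mul_factorial_pred i.pos.ne'
  have h4 : eigenJet ev U θ i 0 * (derivative (nodePoly ev)).eval (ev i) =
      θ ^ (n - 1) * n.factorial := by
    rw [h2, ← h3]
    linear_combination -(n : ℝ) * h1
  have h5 : (derivative (nodePoly ev)).eval (ev i) ≠ 0 := by
    intro h0
    rw [h0, mul_zero] at h4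
    have : (n.factorial : ℝ) ≠ 0 := by positivity
    exact mul_ne_zero (pow_ne_zero _ hθ) this h4.symm
  rw [Lagrange.nodalWeight_eq_eval_derivative_nodal (Finset.mem_univ i), ← h4]
  exact (mul_inv_cancel_right₀ h5 _).symm

/-- Orthogonality of the heat flow jets to the columns of the eigenvector matrix. -/
lemma sum_eigenJet_mul_coeff (hev : Function.Injective ev) (hθ : θ ≠ 0)
    (h : nodePoly ev = hermitePoly U θ n) {m j : ℕ} (hm : m < n) (hj : m < j) :
    ∑ i, eigenJet ev U θ i m * (eigenPoly ev i).coeff j = 0 := by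
  have hd := natDegree_hermitePoly_le U θ m
  have h0 := sum_nodalWeight_mul_coeff_eigenPoly hev (hd.trans_lt hm) j
  rw [coeff_eq_zero_of_natDegree_lt (hd.trans_lt hj)] at h0
  -- The right-hand sum is the `j`-th coefficient of the interpolant of the Hermite polynomial
  -- `H_m`, that is of `H_m` itself, and `j` exceeds its degree.
  have h1 : θ ^ m * ∑ i, eigenJet ev U θ i m * (eigenPoly ev i).coeff j =
      θ ^ (n - 1) * n.factorial * ∑ i, Lagrange.nodalWeight Finset.univ ev i *
        (hermitePoly U θ m).eval (ev i) * (eigenPoly ev i).coeff j := by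
    rw [Finset.mul_sum, Finset.mul_sum]
    refine Finset.sum_congr rfl fun i _ => ?_
    rw [← mul_assoc, eigenJet_eq h i m hm, eigenJet_zero_eq hθ h]
    ring
  rw [h0, mul_zero] at h1
  exact (mul_eq_zero.mp h1).resolve_left (pow_ne_zero _ hθ)

lemma eigenMatrix_mulVec_jet (ev : Fin n → ℝ) (U θ : ℝ) (i : Fin n) (m : ℕ) :
    ∑ k, eigenMatrix ev i k * (derivative^[m] (heat θ (X ^ (k : ℕ)))).eval U =
      eigenJet ev U θ i m := by
  rw [eigenJet]
  conv_rhs => rw [eigenPoly_eq_sum]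
  simp [map_sum, heat_C_mul, iterate_derivative_sum, iterate_derivative_C_mul, eval_finsetSum,
    eigenMatrix]

end

end EQMOM
end

noncomputable section
/-! ## The Jacobians of the sources -/

namespace EQMOM

open Polynomial

variable {N : ℕ}

/-- All three quantities are functions of `M_0`, `M_1`, `M_2` alone, so variations of the higher
moments do not affect them. -/
lemma exists_hasFDerivAt_macroscopic {M : Moments N} (hN : 2 ≤ N) (hρ : density M ≠ 0) :
    ∃ dρ dU dθ : Moments N →L[ℝ] ℝ, HasFDerivAt density dρ M ∧ HasFDerivAt velocity dU M ∧
      HasFDerivAt temperature dθ M ∧ ∀ j : Fin (2 * N + 1), 3 ≤ (j : ℕ) →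
        dρ (Pi.single j 1) = 0 ∧ dU (Pi.single j 1) = 0 ∧ dθ (Pi.single j 1) = 0 := by
  have hc : ∀ k, k < 3 → ∃ d : Moments N →L[ℝ] ℝ, HasFDerivAt (fun M : Moments N => comp M k) d M ∧
      ∀ j : Fin (2 * N + 1), 3 ≤ (j : ℕ) → d (Pi.single j 1) = 0 := by
    intro k hk
    refine ⟨ContinuousLinearMap.proj (R := ℝ) (φ := fun _ : Fin (2 * N + 1) => ℝ)
      ⟨k, by omega⟩, ?_, fun j hj => ?_⟩
    · have : (fun M : Moments N => comp M k) = ContinuousLinearMap.proj (R := ℝ)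
        (φ := fun _ : Fin (2 * N + 1) => ℝ) ⟨k, by omega⟩ := by
        ext M
        simp [comp, show k < 2 * N + 1 by omega]
      rw [this]
      exact ContinuousLinearMap.hasFDerivAt _
    · have : j ≠ ⟨k, by omega⟩ := fun h => by
        have := congrArg Fin.val h
        simp only at this
        omega
      simp [this.symm]
  obtain ⟨d0, h0, z0⟩ := hc 0 (by omega)
  obtain ⟨d1, h1, z1⟩ := hc 1 (by omega)
  obtain ⟨d2, h2, z2⟩ := hc 2 (by omega)
  have hinv : HasFDerivAt (fun M' : Moments N => (density M')⁻¹) _ M :=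
    (hasDerivAt_inv (𝕜 := ℝ) hρ).comp_hasFDerivAt M (show HasFDerivAt density d0 M from h0)
  have hU : HasFDerivAt velocity _ M :=
    (h1.mul hinv).congr_of_eventuallyEq (.of_forall fun _ => div_eq_mul_inv _ _)
  have hθ : HasFDerivAt temperature _ M :=
    ((h2.mul hinv).sub (hU.pow 2)).congr_of_eventuallyEq
      (.of_forall fun M' => congrArg (· - velocity M' ^ 2) (div_eq_mul_inv _ _))
  refine ⟨d0, _, _, h0, hU, hθ, fun j hj => ⟨z0 j hj, ?_, ?_⟩⟩
  · simp [z0 j hj, z1 j hj]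
  · simp [z0 j hj, z1 j hj, z2 j hj]

lemma eventually_temperature_pos {M : Moments N} (hN : 2 ≤ N) (hρ : density M ≠ 0)
    (hθ : 0 < temperature M) :
    ∀ᶠ M' in 𝓝 M, density M' ≠ 0 ∧ 0 < temperature M' := by
  obtain ⟨dρ, dU, dθ, h0, -, h2, -⟩ := exists_hasFDerivAt_macroscopic hN hρ
  exact (h0.continuousAt.eventually_ne hρ).and (h2.continuousAt.eventually (lt_mem_nhds hθ))

lemma exists_hasFDerivAt_gaussMoment {M : Moments N} (hN : 2 ≤ N) (hρ : density M ≠ 0)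
    (hθ : 0 < temperature M) :
    ∃ dU dθ : Moments N →L[ℝ] ℝ, (∀ k : ℕ, HasFDerivAt
      (fun M : Moments N => gaussMoment k (velocity M) (temperature M))
      ((derivative (heat (temperature M) (X ^ k))).eval (velocity M) • dU +
        (derivative^[2] (heat (temperature M) (X ^ k))).eval (velocity M) • dθ) M) ∧
      ∀ j : Fin (2 * N + 1), 3 ≤ (j : ℕ) →
        dU (Pi.single j 1) = 0 ∧ dθ (Pi.single j 1) = 0 := by
  obtain ⟨dρ, dU, dθ, -, h1, h2, hz⟩ := exists_hasFDerivAt_macroscopic hN hρ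
  refine ⟨dU, (1 / 2 : ℝ) • dθ, fun k => ?_, fun j hj => ⟨(hz j hj).2.1, by simp [(hz j hj).2.2]⟩⟩
  have h : HasFDerivAt (fun M' : Moments N => (heat (temperature M') (X ^ k)).eval (velocity M'))
      ((evalHeatDeriv (X ^ k) (velocity M, temperature M)).comp (dU.prod dθ)) M :=
    HasFDerivAt.comp (g := fun y : ℝ × ℝ => (heat y.2 (X ^ k)).eval y.1) M
      (hasStrictFDerivAt_eval_heat (X ^ k) (velocity M, temperature M)).hasFDerivAt (h1.prodMk h2)
  refine (h.congr_of_eventuallyEq ?_).congr_fderiv ?_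
  · filter_upwards [eventually_temperature_pos hN hρ hθ] with M' hM'
    exact gaussMoment_eq hM'.2 _ _
  · ext d
    simp [evalHeatDeriv]

/-- The structure of the Jacobian of the equilibrium moments. -/
lemma exists_hasFDerivAt_equilibriumMoments {M : Moments N} (hN : 2 ≤ N) (hρ : density M ≠ 0)
    (hθ : 0 < temperature M) :
    DifferentiableAt ℝ (equilibriumMoments N) M ∧
    (∃ r : ℕ → Fin (2 * N + 1) → ℝ, ∀ i j, jacobianMatrix (equilibriumMoments N) M i j =
      ∑ m ∈ Finset.range 3,
        (derivative^[m] (heat (temperature M) (X ^ (i : ℕ)))).eval (velocity M) * r m j) ∧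
    (∀ i j : Fin (2 * N + 1), (i : ℕ) < 3 →
      jacobianMatrix (equilibriumMoments N) M i j = if i = j then 1 else 0) ∧
    (∀ i j : Fin (2 * N + 1), 3 ≤ (j : ℕ) →
      jacobianMatrix (equilibriumMoments N) M i j = 0) := by
  obtain ⟨dρ, dV, dT, h0, -, -, hz0⟩ := exists_hasFDerivAt_macroscopic hN hρ
  obtain ⟨dU, dθ, h, hz⟩ := exists_hasFDerivAt_gaussMoment hN hρ hθ
  have hE := hasFDerivAt_pi.mpr fun i : Fin (2 * N + 1) => h0.mul (h i)
  have hE' : HasFDerivAt (equilibriumMoments N) _ M := hE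
  have hjac : ∀ i j, jacobianMatrix (equilibriumMoments N) M i j =
      density M * ((derivative (heat (temperature M) (X ^ (i : ℕ)))).eval (velocity M) *
        dU (Pi.single j 1) + (derivative^[2] (heat (temperature M) (X ^ (i : ℕ)))).eval
          (velocity M) * dθ (Pi.single j 1)) +
      (heat (temperature M) (X ^ (i : ℕ))).eval (velocity M) * dρ (Pi.single j 1) := by
    intro i j
    rw [jacobianMatrix, LinearMap.toMatrix'_apply, hE'.fderiv, ← gaussMoment_eq hθ]
    simp
    ring
  refine ⟨hE'.differentiableAt, ⟨fun m j => if m = 0 then dρ (Pi.single j 1) else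
    if m = 1 then density M * dU (Pi.single j 1) else density M * dθ (Pi.single j 1),
    fun i j => ?_⟩, fun i j hi => ?_, fun i j hj => ?_⟩
  · rw [hjac]
    simp [Finset.sum_range_succ]
    ring
  -- The local equilibrium has the same density, momentum and energy as `M` throughout a
  -- neighbourhood, so these rows are those of the identity.
  · have hloc : (fun M' : Moments N => equilibriumMoments N M' i) =ᶠ[𝓝 M] fun M' => M' i := by
      filter_upwards [eventually_temperature_pos hN hρ hθ] with M' hM'
      obtain ⟨i, hin⟩ := i
      simp only at hi
      have hc : ∀ k (hk : k < 2 * N + 1), M' ⟨k, hk⟩ = comp M' k := fun k hk => by simp [comp, hk]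
      rw [hc]
      simp only [equilibriumMoments]
      interval_cases i
      · rw [gaussMoment_zero hM'.2, mul_one, density]
      · rw [gaussMoment_one hM'.2, velocity, mul_div_cancel₀ _ hM'.1]
      · rw [gaussMoment_two hM'.2, temperature, add_sub_cancel, mul_div_cancel₀ _ hM'.1]
    have h1 := hasFDerivAt_pi'.mp (hE'.differentiableAt.hasFDerivAt) i
    have h2 : HasFDerivAt (fun M' : Moments N => M' i)
        (ContinuousLinearMap.proj (R := ℝ) (φ := fun _ : Fin (2 * N + 1) => ℝ) i) M :=
      hasFDerivAt_apply i M
    have h3 := congrArg (fun f => f (Pi.single j 1)) (h1.unique (h2.congr_of_eventuallyEq hloc))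
    rw [jacobianMatrix, LinearMap.toMatrix'_apply]
    simpa [Pi.single_apply] using h3
  · rw [hjac, (hz0 j hj).1, (hz j hj).1, (hz j hj).2]
    simp

lemma jacobianMatrix_bgkSource {M : Moments N} (h : DifferentiableAt ℝ (equilibriumMoments N) M) :
    DifferentiableAt ℝ (bgkSource N) M ∧
      jacobianMatrix (bgkSource N) M = jacobianMatrix (equilibriumMoments N) M - 1 := by
  have h1 : HasFDerivAt (bgkSource N) _ M := h.hasFDerivAt.sub (hasFDerivAt_id M)
  refine ⟨h1.differentiableAt, ?_⟩
  ext i j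
  rw [jacobianMatrix, LinearMap.toMatrix'_apply, h1.fderiv, Matrix.sub_apply, jacobianMatrix,
    LinearMap.toMatrix'_apply, Matrix.one_apply]
  simp [Pi.single_apply]

/-- At equilibrium `S_3` vanishes, so the product rule keeps only the term in which `S_3` is
differentiated. -/
lemma jacobianMatrix_shakhovSource {M : Moments N} (hN : 2 ≤ N) (hρ : density M ≠ 0)
    (hθ : 0 < temperature M) (hM : bgkSource N M = 0) (Pr : ℝ) :
    DifferentiableAt ℝ (shakhovSource N Pr) M ∧
      jacobianMatrix (shakhovSource N Pr) M = jacobianMatrix (bgkSource N) M -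
        Matrix.of fun i j => (1 - Pr) * heatFluxVector N M i *
          jacobianMatrix (bgkSource N) M ⟨3, by omega⟩ j := by
  have hS : HasFDerivAt (bgkSource N) (fderiv ℝ (bgkSource N) M) M := (jacobianMatrix_bgkSource
    (exists_hasFDerivAt_equilibriumMoments hN hρ hθ).1).1.hasFDerivAt
  obtain ⟨dU, dθ, hg, -⟩ := exists_hasFDerivAt_gaussMoment hN hρ hθ
  have hκ : DifferentiableAt ℝ (heatFluxVector N) M :=
    differentiableAt_pi.mpr fun j : Fin (2 * N + 1) =>
      ((hg ((j : ℕ) - 3)).differentiableAt.const_mul (Nat.choose (j : ℕ) 3 : ℝ))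
  have h3 : HasFDerivAt (fun M' => (1 - Pr) * bgkSource N M' ⟨3, by omega⟩) _ M :=
    (hasFDerivAt_pi'.mp hS ⟨3, by omega⟩).const_mul (1 - Pr)
  have h := hS.sub (h3.smul hκ.hasFDerivAt)
  have hev : shakhovSource N Pr =ᶠ[𝓝 M] bgkSource N -
      (fun M' => (1 - Pr) * bgkSource N M' ⟨3, by omega⟩) • heatFluxVector N := by
    filter_upwards [eventually_temperature_pos hN hρ hθ] with M' hM'
    exact shakhovSource_eq hN hM'.1 hM'.2 Pr
  have h' := h.congr_of_eventuallyEq hev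
  refine ⟨h'.differentiableAt, ?_⟩
  ext i j
  rw [jacobianMatrix, LinearMap.toMatrix'_apply, h'.fderiv]
  simp [jacobianMatrix, LinearMap.toMatrix'_apply, hM]
  ring

/-- The derivative of `ν` is multiplied by the vanishing source. -/
lemma jacobianMatrix_smul {n : ℕ} {ν : (Fin n → ℝ) → ℝ} {S : (Fin n → ℝ) → Fin n → ℝ}
    {M : Fin n → ℝ} (hν : DifferentiableAt ℝ ν M) (hS : DifferentiableAt ℝ S M) (hM : S M = 0) :
    DifferentiableAt ℝ (fun M => ν M • S M) M ∧
      jacobianMatrix (fun M => ν M • S M) M = ν M • jacobianMatrix S M := by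
  have h := hν.hasFDerivAt.smul hS.hasFDerivAt
  refine ⟨h.differentiableAt, ?_⟩
  ext i j
  rw [jacobianMatrix, LinearMap.toMatrix'_apply]
  have h' : HasFDerivAt (fun M => ν M • S M) _ M := h
  rw [h'.fderiv]
  simp [jacobianMatrix, LinearMap.toMatrix'_apply, hM]

end EQMOM
end

noncomputable section
/-! ## The diagonalizers -/

/-! ### Conjugation by nilpotent shears, in an abstract ring -/

section Ring

variable {R : Type*} [Ring R] {q n f e : R}

/-- Here `q` stands for the projection `lowerOne` and `n` for `lowerJacobian`; the hypotheses make
`n` square to zero, so `1 - n` is a shear that removes the lower left block of the BGK Jacobian. -/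
lemma one_sub_mul_sub (hqn : q * n = n) (hnq : n * q = 0) :
    (1 - n) * (n - q) = -q * (1 - n) := by
  have hnn : n * n = 0 := by
    calc n * n = n * (q * n) := by rw [hqn]
      _ = 0 := by rw [← mul_assoc, hnq, zero_mul]
  simp only [mul_sub, sub_mul, mul_one, one_mul, hnn, hqn, hnq, neg_mul]
  abel

lemma one_sub_mul_one_add (hqn : q * n = n) (hnq : n * q = 0) : (1 - n) * (1 + n) = 1 := by
  have hnn : n * n = 0 := by
    calc n * n = n * (q * n) := by rw [hqn]
      _ = 0 := by rw [← mul_assoc, hnq, zero_mul]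
  simp only [mul_add, sub_mul, mul_one, one_mul, hnn]
  abel

lemma one_sub_mul_one_sub_mul (hqn : q * n = n) (hnq : n * q = 0) (hqf : q * f = f)
    (hff : f * f = 0) : (1 - f) * (1 - n) * (1 + n + f) = 1 := by
  have hnf : n * f = 0 := by rw [← hqf, ← mul_assoc, hnq, zero_mul]
  have hf : (1 - n) * f = f := by rw [sub_mul, one_mul, hnf, sub_zero]
  rw [mul_assoc, mul_add (1 - n), one_sub_mul_one_add hqn hnq, hf]
  simp only [mul_add, sub_mul, mul_one, one_mul, hff]
  abel

/-- Two shears in succession: `1 - n` removes the lower left block, then `1 - f` removes `f` from `q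
- s (f + e)`, because `f e = f` while `e f = 0`. Here `f` is the heat flux shear, `e` the fourth
matrix unit and `s = 1 - Pr`. -/
lemma shear_conjugation [Algebra ℝ R] (hqn : q * n = n) (hnq : n * q = 0) (hqf : q * f = f)
    (hfq : f * q = f) (hff : f * f = 0) (hqe : q * e = e) (heq : e * q = e) (hfe : f * e = f)
    (hef : e * f = 0) (s : ℝ) :
    (1 - f) * (1 - n) * ((n - q) - s • ((f + e) * (n - q))) =
      -(q - s • e) * ((1 - f) * (1 - n)) := by
  have hnf : n * f = 0 := by rw [← hqf, ← mul_assoc, hnq, zero_mul]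
  have hne : n * e = 0 := by rw [← hqe, ← mul_assoc, hnq, zero_mul]
  have h1 : n - q = -q * (1 - n) := by simp only [mul_sub, neg_mul, mul_one, hqn]; abel
  have h2 : (1 - n) * ((n - q) - s • ((f + e) * (n - q))) = -(q - s • (f + e)) * (1 - n) := by
    have h3 : (1 - n) * ((f + e) * (n - q)) = -(f + e) * (1 - n) := by
      rw [h1, ← mul_assoc, ← mul_assoc]
      congr 1
      simp only [mul_add, add_mul, sub_mul, one_mul, mul_neg, hnf, hne, hfq, heq, zero_mul]
      abel
    rw [mul_sub, one_sub_mul_sub hqn hnq, mul_smul_comm, h3, ← smul_mul_assoc, ← sub_mul, smul_neg]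
    congr 1
    abel
  rw [mul_assoc, h2, ← mul_assoc, ← mul_assoc]
  congr 1
  simp only [mul_sub, sub_mul, mul_add, one_mul, mul_one, mul_neg, neg_mul, smul_add, hfq,
    mul_smul_comm, smul_mul_assoc, hff, hfe, hqf, hef, smul_zero]
  module

end Ring

namespace EQMOM

open Polynomial Matrix

variable {N : ℕ}

/-- The block diagonal matrix `diag(0, 0, 0, 1, …, 1)`. -/
def lowerOne (N : ℕ) : Matrix (Fin (2 * N + 1)) (Fin (2 * N + 1)) ℝ :=
  diagonal fun i => if (i : ℕ) < 3 then 0 else 1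

/-- The lower left block of the Jacobian of the equilibrium moments. -/
def lowerJacobian (N : ℕ) (M : Moments N) : Matrix (Fin (2 * N + 1)) (Fin (2 * N + 1)) ℝ :=
  lowerOne N * jacobianMatrix (equilibriumMoments N) M

/-- The strictly lower part of the fourth column, given by the heat flux vector. -/
def heatFluxShear (N : ℕ) (M : Moments N) : Matrix (Fin (2 * N + 1)) (Fin (2 * N + 1)) ℝ :=
  of fun i j => if 4 ≤ (i : ℕ) ∧ (j : ℕ) = 3 then
    (Nat.choose (i : ℕ) 3 : ℝ) * gaussMoment ((i : ℕ) - 3) (velocity M) (temperature M) else 0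

/-- The matrix unit in the fourth row and column. -/
def fourthUnit (N : ℕ) : Matrix (Fin (2 * N + 1)) (Fin (2 * N + 1)) ℝ :=
  diagonal fun i => if (i : ℕ) = 3 then 1 else 0

lemma lowerOne_mul_lowerJacobian (M : Moments N) :
    lowerOne N * lowerJacobian N M = lowerJacobian N M := by
  rw [lowerJacobian, ← Matrix.mul_assoc]
  congr 1
  simp [lowerOne]

lemma lowerOne_mul_heatFluxShear (M : Moments N) :
    lowerOne N * heatFluxShear N M = heatFluxShear N M := by
  ext i j
  simp only [lowerOne, diagonal_mul, heatFluxShear, of_apply]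
  split_ifs <;> first | omega | simp

lemma heatFluxShear_mul_lowerOne (M : Moments N) :
    heatFluxShear N M * lowerOne N = heatFluxShear N M := by
  ext i j
  simp only [lowerOne, mul_diagonal, heatFluxShear, of_apply]
  split_ifs <;> first | omega | simp

lemma heatFluxShear_mul_self (M : Moments N) : heatFluxShear N M * heatFluxShear N M = 0 := by
  ext i j
  rw [mul_apply, Matrix.zero_apply]
  refine Finset.sum_eq_zero fun k _ => ?_
  simp only [heatFluxShear, of_apply]
  split_ifs <;> first | omega | simp

lemma lowerOne_mul_fourthUnit : lowerOne N * fourthUnit N = fourthUnit N := by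
  simp only [lowerOne, fourthUnit, diagonal_mul_diagonal]
  congr 1
  ext i
  split_ifs <;> first | omega | simp

lemma fourthUnit_mul_lowerOne : fourthUnit N * lowerOne N = fourthUnit N := by
  simp only [lowerOne, fourthUnit, diagonal_mul_diagonal]
  congr 1
  ext i
  split_ifs <;> first | omega | simp

lemma heatFluxShear_mul_fourthUnit (M : Moments N) :
    heatFluxShear N M * fourthUnit N = heatFluxShear N M := by
  ext i j
  simp only [fourthUnit, mul_diagonal, heatFluxShear, of_apply]
  split_ifs <;> first | omega | simp

lemma fourthUnit_mul_heatFluxShear (M : Moments N) :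
    fourthUnit N * heatFluxShear N M = 0 := by
  ext i j
  simp only [fourthUnit, diagonal_mul, heatFluxShear, of_apply, Matrix.zero_apply]
  split_ifs <;> first | omega | simp

/-- The binomial `binom(i, 3)` vanishes for `i < 3` and is `1` at `i = 3`, so shear and unit
together form the whole heat flux vector in one column. -/
lemma heatFluxShear_add_fourthUnit_apply {M : Moments N} (hθ : 0 < temperature M)
    (i j : Fin (2 * N + 1)) : (heatFluxShear N M + fourthUnit N) i j =
      if (j : ℕ) = 3 then heatFluxVector N M i else 0 := by
  simp only [Matrix.add_apply, heatFluxShear, fourthUnit, of_apply, diagonal_apply, heatFluxVector]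
  by_cases hj : (j : ℕ) = 3
  · rcases lt_trichotomy (i : ℕ) 3 with hi | hi | hi
    · have hij : i ≠ j := fun h => by rw [h] at hi; omega
      simp [hj, hij, Nat.choose_eq_zero_of_lt hi, show ¬ 4 ≤ (i : ℕ) by omega]
    · have hij : i = j := Fin.ext (hi.trans hj.symm)
      simp [hij, hj, gaussMoment_zero hθ]
    · have hij : i ≠ j := fun h => by rw [h] at hi; omega
      simp [hj, hij, show 4 ≤ (i : ℕ) by omega]
  · by_cases hij : i = j
    · simp [hij, hj]
    · simp [hij, hj]

section

variable {M : Moments N} (hN : 2 ≤ N) (hρ : density M ≠ 0) (hθ : 0 < temperature M)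

include hN hρ hθ

lemma lowerJacobian_mul_lowerOne : lowerJacobian N M * lowerOne N = 0 := by
  obtain ⟨-, -, -, h⟩ := exists_hasFDerivAt_equilibriumMoments hN hρ hθ
  rw [lowerJacobian, Matrix.mul_assoc]
  convert Matrix.mul_zero _
  ext i j
  simp only [lowerOne, mul_diagonal, Matrix.zero_apply]
  split_ifs with hj
  · simp
  · rw [h i j (by omega), zero_mul]

lemma jacobianMatrix_equilibriumMoments_eq : jacobianMatrix (equilibriumMoments N) M =
    1 - lowerOne N + lowerJacobian N M := by
  obtain ⟨-, -, h, -⟩ := exists_hasFDerivAt_equilibriumMoments hN hρ hθ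
  ext i j
  simp only [lowerJacobian, lowerOne, diagonal_mul, Matrix.add_apply, Matrix.sub_apply,
    Matrix.one_apply, diagonal_apply]
  by_cases hi : (i : ℕ) < 3
  · rw [h i j hi]
    simp [hi]
  · by_cases hij : i = j
    · subst hij
      simp [hi]
    · simp [hi, hij]

lemma jacobianMatrix_bgkSource_eq :
    jacobianMatrix (bgkSource N) M = lowerJacobian N M - lowerOne N := by
  rw [(jacobianMatrix_bgkSource (exists_hasFDerivAt_equilibriumMoments hN hρ hθ).1).2,
    jacobianMatrix_equilibriumMoments_eq hN hρ hθ]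
  abel

lemma bgkDiagonalizer_eq : bgkDiagonalizer N M = 1 - lowerJacobian N M := by
  obtain ⟨-, -, -, h⟩ := exists_hasFDerivAt_equilibriumMoments hN hρ hθ
  ext i j
  simp only [bgkDiagonalizer, lowerJacobian, lowerOne, diagonal_mul, Matrix.sub_apply,
    Matrix.one_apply]
  by_cases hj : (j : ℕ) < 3
  · by_cases hi : (i : ℕ) < 3
    · simp [hi, show ¬ 3 ≤ (i : ℕ) by omega]
    · have hij : i ≠ j := fun h => hi (h ▸ hj)
      simp [hi, hij, hj, show 3 ≤ (i : ℕ) by omega]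
  · simp [hj, h i j (by omega)]

lemma bgkDiagonalizer_mul : bgkDiagonalizer N M * (1 + lowerJacobian N M) = 1 := by
  rw [bgkDiagonalizer_eq hN hρ hθ]
  exact one_sub_mul_one_add (lowerOne_mul_lowerJacobian M)
    (lowerJacobian_mul_lowerOne hN hρ hθ)

lemma bgkDiagonalizer_inv : (bgkDiagonalizer N M)⁻¹ = 1 + lowerJacobian N M :=
  inv_eq_right_inv (bgkDiagonalizer_mul hN hρ hθ)

lemma bgkDiagonalizer_mul_jacobianMatrix :
    bgkDiagonalizer N M * jacobianMatrix (bgkSource N) M = -lowerOne N * bgkDiagonalizer N M := by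
  rw [bgkDiagonalizer_eq hN hρ hθ, jacobianMatrix_bgkSource_eq hN hρ hθ]
  exact one_sub_mul_sub (lowerOne_mul_lowerJacobian M)
    (lowerJacobian_mul_lowerOne hN hρ hθ)

lemma shear_mul_bgkDiagonalizer_mul :
    (1 - heatFluxShear N M) * (1 - lowerJacobian N M) *
      (1 + lowerJacobian N M + heatFluxShear N M) = 1 :=
  one_sub_mul_one_sub_mul (lowerOne_mul_lowerJacobian M)
    (lowerJacobian_mul_lowerOne hN hρ hθ) (lowerOne_mul_heatFluxShear M) (heatFluxShear_mul_self M)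

lemma shakhovDiagonalizer_eq :
    shakhovDiagonalizer N M = (1 - heatFluxShear N M) * (1 - lowerJacobian N M) := by
  rw [shakhovDiagonalizer, bgkDiagonalizer_inv hN hρ hθ]
  exact inv_eq_left_inv (shear_mul_bgkDiagonalizer_mul hN hρ hθ)

lemma shakhovDiagonalizer_mul :
    shakhovDiagonalizer N M * (1 + lowerJacobian N M + heatFluxShear N M) = 1 := by
  rw [shakhovDiagonalizer_eq hN hρ hθ]
  exact shear_mul_bgkDiagonalizer_mul hN hρ hθ

lemma shakhovDiagonalizer_inv :
    (shakhovDiagonalizer N M)⁻¹ = 1 + lowerJacobian N M + heatFluxShear N M :=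
  inv_eq_right_inv (shakhovDiagonalizer_mul hN hρ hθ)

lemma shakhovDiagonalizer_mul_jacobianMatrix (hM : bgkSource N M = 0) (Pr : ℝ) :
    shakhovDiagonalizer N M * jacobianMatrix (shakhovSource N Pr) M =
      -(lowerOne N - (1 - Pr) • fourthUnit N) * shakhovDiagonalizer N M := by
  have hjac : jacobianMatrix (shakhovSource N Pr) M = (lowerJacobian N M - lowerOne N) -
      (1 - Pr) • ((heatFluxShear N M + fourthUnit N) * (lowerJacobian N M - lowerOne N)) := by
    rw [(jacobianMatrix_shakhovSource hN hρ hθ hM Pr).2, ← jacobianMatrix_bgkSource_eq hN hρ hθ]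
    congr 1
    ext i j
    rw [Matrix.smul_apply, mul_apply, Finset.sum_eq_single ⟨3, by omega⟩]
    · simp only [heatFluxShear_add_fourthUnit_apply hθ, of_apply, if_true, smul_eq_mul]
      ring
    · intro k _ hk
      rw [heatFluxShear_add_fourthUnit_apply hθ, if_neg (fun h => hk (Fin.ext h)), zero_mul]
    · simp
  rw [hjac, shakhovDiagonalizer_eq hN hρ hθ]
  exact shear_conjugation (lowerOne_mul_lowerJacobian M) (lowerJacobian_mul_lowerOne hN hρ hθ)
    (lowerOne_mul_heatFluxShear M) (heatFluxShear_mul_lowerOne M) (heatFluxShear_mul_self M)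
    lowerOne_mul_fourthUnit fourthUnit_mul_lowerOne (heatFluxShear_mul_fourthUnit M)
    (fourthUnit_mul_heatFluxShear M) (1 - Pr)

end

end EQMOM
end

noncomputable section
/-! ## Orthogonality at equilibrium -/

namespace EQMOM

open Polynomial Matrix

variable {N : ℕ}

lemma nodePoly_eq_of_coeff_eq {n : ℕ} {ev ev' : Fin n → ℝ}
    (h : ∀ j : Fin n, (nodePoly ev).coeff j = (nodePoly ev').coeff j) :
    nodePoly ev = nodePoly ev' := by
  have hd : ∀ ev : Fin n → ℝ, (nodePoly ev).natDegree = n := fun ev => by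
    simp [nodePoly, Lagrange.natDegree_nodal]
  have h1 := (Lagrange.nodal_monic (s := Finset.univ) (v := ev)).as_sum
  have h2 := (Lagrange.nodal_monic (s := Finset.univ) (v := ev')).as_sum
  rw [hd, Finset.sum_range] at h1 h2
  refine h1.trans ((congrArg (X ^ n + ·) (Finset.sum_congr rfl fun j _ => ?_)).trans h2.symm)
  exact congrArg (fun a => C a * X ^ (j : ℕ)) (h j)

/-- At equal nodes the double nodes and the simple node merge into `(X - U) ^ (2N + 1)`, and the
backward flow turns this into a Hermite polynomial. -/
lemma nodePoly_eq_hermitePoly (hN : 2 ≤ N) {M : Moments N} (hM : M ∈ momentMap N '' domainEq N)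
    {ev : Fin (2 * N + 1) → ℝ}
    (h : closingCoeff N M = fun j : Fin (2 * N + 1) => -(nodePoly ev).coeff j) :
    nodePoly ev = hermitePoly (velocity M) (temperature M) (2 * N + 1) := by
  have : NeZero N := ⟨by omega⟩
  obtain ⟨W, hW, rfl⟩ := hM
  obtain ⟨ev', -, h'⟩ := exists_roots_charPoly hW.2.1 (velocity (momentMap N W))
  have h2 := velocity_and_temperature_of_mem_domainEq hW
  rw [hermitePoly, ← h2.2, ← charPoly_of_const h2.1, h']
  refine nodePoly_eq_of_coeff_eq fun j => ?_
  rw [closingCoeff_of_mem_domainEq hN hW, h'] at h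
  exact (neg_injective (congrFun h j)).symm

section

variable {M : Moments N} {ev : Fin (2 * N + 1) → ℝ}

/-- The `m`-jets are orthogonal to the later columns of the eigenvector matrix. -/
lemma sum_eigenJet_mul_eigenMatrix (hev : Function.Injective ev) (hθ : 0 < temperature M)
    (h : nodePoly ev = hermitePoly (velocity M) (temperature M) (2 * N + 1)) {m : ℕ}
    {j : Fin (2 * N + 1)} (hm : m < (j : ℕ)) :
    ∑ k, eigenJet ev (velocity M) (temperature M) k m * eigenMatrix ev k j = 0 :=
  sum_eigenJet_mul_coeff hev hθ.ne' h (hm.trans j.2) hm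

/-- The first three columns of `P⁻¹` are derivatives of the equilibrium moments in `M_0`, `M_1`,
`M_2`. By the chain rule and the heat equation they combine `u`-derivatives of Gaussian moments of
order at most two. -/
lemma exists_eigenMatrix_mul_lowerJacobian (hN : 2 ≤ N) (hρ : density M ≠ 0)
    (hθ : 0 < temperature M) (ev : Fin (2 * N + 1) → ℝ) :
    ∃ r : ℕ → Fin (2 * N + 1) → ℝ, ∀ k i : Fin (2 * N + 1), (i : ℕ) < 3 →
      (eigenMatrix ev * (1 + lowerJacobian N M)) k i = ∑ m ∈ Finset.range 3,
        eigenJet ev (velocity M) (temperature M) k m * r m i := by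
  obtain ⟨-, ⟨r, hr⟩, -, -⟩ := exists_hasFDerivAt_equilibriumMoments hN hρ hθ
  refine ⟨r, fun k i hi => ?_⟩
  have h1 : ∀ l, (1 + lowerJacobian N M) l i = jacobianMatrix (equilibriumMoments N) M l i := by
    intro l
    rw [jacobianMatrix_equilibriumMoments_eq hN hρ hθ]
    simp only [Matrix.add_apply, Matrix.sub_apply, lowerOne, diagonal_apply]
    by_cases hl : l = i
    · simp [hl, hi]
    · simp [hl]
  simp only [mul_apply, h1, hr, ← eigenMatrix_mulVec_jet, Finset.mul_sum, Finset.sum_mul]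
  rw [Finset.sum_comm]
  exact Finset.sum_congr rfl fun m _ => Finset.sum_congr rfl fun l _ => by ring

lemma eigenMatrix_mul_lowerJacobian_of_le (hN : 2 ≤ N) (hρ : density M ≠ 0)
    (hθ : 0 < temperature M) (ev : Fin (2 * N + 1) → ℝ) (k j : Fin (2 * N + 1))
    (hj : 3 ≤ (j : ℕ)) :
    (eigenMatrix ev * (1 + lowerJacobian N M)) k j = eigenMatrix ev k j := by
  obtain ⟨-, -, -, h⟩ := exists_hasFDerivAt_equilibriumMoments hN hρ hθ
  have h1 : ∀ l, lowerJacobian N M l j = 0 := by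
    intro l
    rw [lowerJacobian, lowerOne, diagonal_mul, h l j hj, mul_zero]
  rw [Matrix.mul_add, Matrix.mul_one, Matrix.add_apply, mul_apply]
  simp [h1]

lemma eigenMatrix_mul_heatFluxShear_of_ne (ev : Fin (2 * N + 1) → ℝ) (k j : Fin (2 * N + 1))
    (hj : (j : ℕ) ≠ 3) : (eigenMatrix ev * heatFluxShear N M) k j = 0 := by
  rw [mul_apply]
  simp [heatFluxShear, hj]

lemma eigenMatrix_add_mul_heatFluxShear (hθ : 0 < temperature M) (ev : Fin (2 * N + 1) → ℝ)
    (k j : Fin (2 * N + 1)) (hj : (j : ℕ) = 3) :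
    eigenMatrix ev k j + (eigenMatrix ev * heatFluxShear N M) k j =
      ∑ l, eigenMatrix ev k l * heatFluxVector N M l := by
  have h1 : (eigenMatrix ev * (heatFluxShear N M + fourthUnit N)) k j =
      ∑ l, eigenMatrix ev k l * heatFluxVector N M l := by
    rw [mul_apply]
    simp only [heatFluxShear_add_fourthUnit_apply hθ, if_pos hj]
  rw [← h1, Matrix.mul_add, Matrix.add_apply, fourthUnit, mul_diagonal, if_pos hj, mul_one,
    add_comm]

/-- The third `u`-derivative of `Δ_l` is `6 binom(l, 3) Δ_{l-3}`, so the heat flux vector is a third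
jet. -/
lemma sum_eigenMatrix_mul_heatFluxVector (hθ : 0 < temperature M) (ev : Fin (2 * N + 1) → ℝ)
    (k : Fin (2 * N + 1)) : ∑ l, eigenMatrix ev k l * heatFluxVector N M l =
      1 / 6 * eigenJet ev (velocity M) (temperature M) k 3 := by
  rw [← eigenMatrix_mulVec_jet, Finset.mul_sum]
  refine Finset.sum_congr rfl fun l _ => ?_
  rw [heatFluxVector, gaussMoment_eq hθ, iterate_derivative_heat,
    iterate_derivative_X_pow_eq_C_mul, heat_C_mul, Nat.descFactorial_eq_factorial_mul_choose]
  simp only [eval_mul, eval_C, Nat.cast_mul, show (Nat.factorial 3 : ℕ) = 6 from rfl]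
  push_cast
  ring

lemma sum_mul_of_first_three (hN : 2 ≤ N) (hρ : density M ≠ 0) (hθ : 0 < temperature M)
    {x : Fin (2 * N + 1) → ℝ}
    (hx : ∀ m < 3, ∑ k, eigenJet ev (velocity M) (temperature M) k m * x k = 0)
    {i : Fin (2 * N + 1)} (hi : (i : ℕ) < 3) :
    ∑ k, (eigenMatrix ev * (1 + lowerJacobian N M)) k i * x k = 0 := by
  obtain ⟨r, hr⟩ := exists_eigenMatrix_mul_lowerJacobian hN hρ hθ ev
  simp only [hr _ i hi, Finset.sum_mul]
  rw [Finset.sum_comm]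
  refine Finset.sum_eq_zero fun m hm => ?_
  rw [← mul_zero (r m i), ← hx m (Finset.mem_range.mp hm), Finset.mul_sum]
  exact Finset.sum_congr rfl fun k _ => by ring

/-- Jets of order at most two meet unchanged columns of `L` of index at least three. -/
theorem bgk_orthogonal (hN : 2 ≤ N) (hρ : density M ≠ 0) (hθ : 0 < temperature M)
    (hev : Function.Injective ev)
    (h : nodePoly ev = hermitePoly (velocity M) (temperature M) (2 * N + 1)) :
    FirstThreeColumnsOrthogonal (eigenMatrix ev * (bgkDiagonalizer N M)⁻¹) := by
  intro i j hi hj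
  rw [bgkDiagonalizer_inv hN hρ hθ]
  simp only [eigenMatrix_mul_lowerJacobian_of_le hN hρ hθ ev _ j hj]
  exact sum_mul_of_first_three hN hρ hθ
    (fun m hm => sum_eigenJet_mul_eigenMatrix hev hθ h (by omega)) hi

lemma shakhov_column (hN : 2 ≤ N) (hρ : density M ≠ 0) (hθ : 0 < temperature M)
    (ev : Fin (2 * N + 1) → ℝ) (k j : Fin (2 * N + 1)) :
    (eigenMatrix ev * (shakhovDiagonalizer N M)⁻¹) k j =
      if (j : ℕ) = 3 then 1 / 6 * eigenJet ev (velocity M) (temperature M) k 3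
      else (eigenMatrix ev * (1 + lowerJacobian N M)) k j := by
  rw [shakhovDiagonalizer_inv hN hρ hθ, Matrix.mul_add, Matrix.add_apply]
  split_ifs with hj
  · rw [eigenMatrix_mul_lowerJacobian_of_le hN hρ hθ ev k j hj.ge,
      eigenMatrix_add_mul_heatFluxShear hθ ev k j hj, sum_eigenMatrix_mul_heatFluxVector hθ]
  · rw [eigenMatrix_mul_heatFluxShear_of_ne ev k j hj, add_zero]

/-- Only the fourth column differs from the BGK case. Expanded in columns of `L`, the third jet
involves only indices at least three, to which jets of order at most two are orthogonal. -/
theorem shakhov_orthogonal (hN : 2 ≤ N) (hρ : density M ≠ 0) (hθ : 0 < temperature M)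
    (hev : Function.Injective ev)
    (h : nodePoly ev = hermitePoly (velocity M) (temperature M) (2 * N + 1)) :
    FirstThreeColumnsOrthogonal (eigenMatrix ev * (shakhovDiagonalizer N M)⁻¹) := by
  intro i j hi hj
  simp only [shakhov_column hN hρ hθ, if_neg hi.ne]
  refine sum_mul_of_first_three hN hρ hθ (fun m hm => ?_) hi
  split_ifs with hj3
  · simp only [← sum_eigenMatrix_mul_heatFluxVector hθ ev, Finset.mul_sum]
    rw [Finset.sum_comm]
    refine Finset.sum_eq_zero fun l _ => ?_
    by_cases hl : m < (l : ℕ)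
    · rw [← mul_zero (heatFluxVector N M l), ← sum_eigenJet_mul_eigenMatrix hev hθ h hl,
        Finset.mul_sum]
      exact Finset.sum_congr rfl fun k _ => by ring
    · simp [heatFluxVector, Nat.choose_eq_zero_of_lt (show (l : ℕ) < 3 by omega)]
  · simp only [eigenMatrix_mul_lowerJacobian_of_le hN hρ hθ ev _ j hj]
    exact sum_eigenJet_mul_eigenMatrix hev hθ h (by omega)

/-- Needed because the fourth mode relaxes at rate `Pr` and the later ones at rate `1`. -/
theorem shakhov_fourth_orthogonal (hN : 2 ≤ N) (hρ : density M ≠ 0) (hθ : 0 < temperature M)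
    (hev : Function.Injective ev)
    (h : nodePoly ev = hermitePoly (velocity M) (temperature M) (2 * N + 1))
    {i j : Fin (2 * N + 1)} (hi : (i : ℕ) = 3) (hj : 4 ≤ (j : ℕ)) :
    ∑ k, (eigenMatrix ev * (shakhovDiagonalizer N M)⁻¹) k i *
      (eigenMatrix ev * (shakhovDiagonalizer N M)⁻¹) k j = 0 := by
  simp only [shakhov_column hN hρ hθ, if_pos hi, if_neg (show ¬ (j : ℕ) = 3 by omega),
    eigenMatrix_mul_lowerJacobian_of_le hN hρ hθ ev _ j (by omega), mul_assoc]
  rw [← Finset.mul_sum, sum_eigenJet_mul_eigenMatrix hev hθ h (by omega), mul_zero]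

end

end EQMOM
end

noncomputable section
/-! ## The structural stability condition -/

open Matrix

/-! ### The coupling inequality for diagonalizable sources -/

section Coupling

variable {n : ℕ}

lemma sum_sq_mulVec_le (A : Matrix (Fin n) (Fin n) ℝ) (x : Fin n → ℝ) :
    ∑ i, (A *ᵥ x) i ^ 2 ≤ (∑ i, ∑ j, A i j ^ 2) * ∑ j, x j ^ 2 := by
  rw [Finset.sum_mul]
  exact Finset.sum_le_sum fun i _ => Finset.sum_mul_sq_le_sq_mul_sq Finset.univ (A i) x

lemma exists_posSemidef_transpose_mul_self_sub {C : Matrix (Fin n) (Fin n) ℝ} (hC : IsUnit C) :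
    ∃ b : ℝ, 0 < b ∧ (Cᵀ * C - b • (1 : Matrix (Fin n) (Fin n) ℝ)).PosSemidef := by
  -- The Frobenius norm bounds `|x|²` by a multiple of `|C x|²`; the summand `1` keeps `K` positive
  -- even when `n = 0`.
  set K : ℝ := 1 + ∑ i, ∑ j, (C⁻¹) i j ^ 2 with hK
  have hK0 : 0 ≤ ∑ i, ∑ j, (C⁻¹) i j ^ 2 :=
    Finset.sum_nonneg fun i _ => Finset.sum_nonneg fun j _ => sq_nonneg _
  have hKpos : 0 < K := by linarith
  have hdet : IsUnit C.det := (isUnit_iff_isUnit_det C).mp hC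
  refine ⟨K⁻¹, inv_pos.mpr hKpos, PosSemidef.of_dotProduct_mulVec_nonneg ?_ fun x => ?_⟩
  · rw [IsHermitian, conjTranspose_eq_transpose_of_trivial, transpose_sub, transpose_mul,
      transpose_transpose, transpose_smul, transpose_one]
  · have h1 := sum_sq_mulVec_le C⁻¹ (C *ᵥ x)
    rw [mulVec_mulVec, nonsing_inv_mul C hdet, one_mulVec] at h1
    have h2 : ∑ j, x j ^ 2 ≤ K * ∑ j, (C *ᵥ x) j ^ 2 := by
      refine h1.trans ?_
      gcongr
      linarith
    have h3 : star x ⬝ᵥ (Cᵀ * C - K⁻¹ • (1 : Matrix (Fin n) (Fin n) ℝ)) *ᵥ x =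
        ∑ j, (C *ᵥ x) j ^ 2 - K⁻¹ * ∑ j, x j ^ 2 := by
      rw [star_trivial, sub_mulVec, dotProduct_sub, smul_mulVec, one_mulVec, dotProduct_smul,
        ← mulVec_mulVec, dotProduct_mulVec, vecMul_transpose]
      simp [dotProduct, sq]
    rw [h3, sub_nonneg, inv_mul_le_iff₀ hKpos]
    exact h2

/-- If `Y R Y⁻¹ = -diag(t)` and the columns of `L Y⁻¹` with different values of `t` are orthogonal,
then `LᵀL` satisfies the coupling inequality, after rescaling the block where `t` is positive. -/
lemma exists_coupling {L Y R : Matrix (Fin n) (Fin n) ℝ} {t : Fin n → ℝ} {p : Fin n → Prop}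
    [DecidablePred p] {τ ν : ℝ} (hL : IsUnit L) (hY : IsUnit Y) (hR : Y * R = -diagonal t * Y)
    (hτ : 0 < τ) (ht₀ : ∀ i, p i → t i = 0) (ht₁ : ∀ i, ¬ p i → τ ≤ t i) (hν : 0 < ν)
    (horth : ∀ i j, t i ≠ t j → ((L * Y⁻¹)ᵀ * (L * Y⁻¹)) i j = 0) :
    ∃ c : ℝ, 0 < c ∧
      (-((diagonal (fun i => if p i then 1 else c) * Y)ᵀ *
          diagonal (fun i => if p i then 0 else 1) *
          (diagonal (fun i => if p i then 1 else c) * Y)) -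
        (Lᵀ * L * (ν • R) + (ν • R)ᵀ * (Lᵀ * L))).PosSemidef := by
  have hdet : IsUnit Y.det := (isUnit_iff_isUnit_det Y).mp hY
  obtain ⟨b, hb, hB⟩ := exists_posSemidef_transpose_mul_self_sub
    (hL.mul ((isUnit_nonsing_inv_iff).mpr hY) : IsUnit (L * Y⁻¹))
  set B := (L * Y⁻¹)ᵀ * (L * Y⁻¹) with hBdef
  have htnn : ∀ i, 0 ≤ t i := fun i => by
    by_cases hp : p i
    · exact (ht₀ i hp).ge
    · exact hτ.le.trans (ht₁ i hp)
  -- The right-hand side of the inequality scales with `c²`, which is set to the guaranteed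
  -- dissipation: lower bound `b` of `B`, smallest rate `τ`, frequency `ν` and a factor two from
  -- symmetrization.
  set c := √(2 * ν * b * τ) with hc
  have hcsq : c * c = 2 * ν * b * τ := Real.mul_self_sqrt (by positivity)
  set s : Fin n → ℝ := fun i => √(t i) with hs
  have hss : ∀ i, s i * s i = t i := fun i => Real.mul_self_sqrt (htnn i)
  have hBt : Bᵀ = B := by rw [hBdef, transpose_mul, transpose_transpose]
  -- Orthogonality makes `B` block diagonal with respect to the values of `t`, so it commutes with
  -- `diagonal t` and the square root can be split over both sides.
  have hBT : B * diagonal t = diagonal s * B * diagonal s := by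
    ext i j
    rw [mul_diagonal, mul_diagonal, diagonal_mul]
    by_cases h : t i = t j
    · have : s i = s j := by simp only [hs, h]
      rw [← hss, this]
      ring
    · rw [horth i j h]
      ring
  have hTB : diagonal t * B = diagonal s * B * diagonal s := by
    have := congrArg transpose hBT
    simpa [transpose_mul, hBt, Matrix.mul_assoc] using this
  have hLL : Lᵀ * L = Yᵀ * B * Y := by
    have h1 : Y⁻¹ * Y = 1 := nonsing_inv_mul Y hdet
    have h2 : L = L * Y⁻¹ * Y := by rw [Matrix.mul_assoc, h1, Matrix.mul_one]
    conv_lhs => rw [h2]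
    rw [hBdef, transpose_mul (L * Y⁻¹) Y]
    simp only [Matrix.mul_assoc]
  have hA : Lᵀ * L * R = -(Yᵀ * (diagonal s * B * diagonal s) * Y) := by
    rw [hLL, Matrix.mul_assoc _ Y R, hR, ← hBT]
    simp only [Matrix.mul_assoc, Matrix.neg_mul, Matrix.mul_neg]
  have hA' : Rᵀ * (Lᵀ * L) = -(Yᵀ * (diagonal s * B * diagonal s) * Y) := by
    have := congrArg transpose hA
    simpa [transpose_mul, hBt, Matrix.mul_assoc] using this
  -- The difference of the two sides splits into a congruence of `B - b`, which is positive
  -- semidefinite by the choice of `b`, and a diagonal term with the surplus rates `t i - τ`.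
  have key : -((diagonal (fun i => if p i then 1 else c) * Y)ᵀ *
          diagonal (fun i => if p i then 0 else 1) *
          (diagonal (fun i => if p i then 1 else c) * Y)) -
        (Lᵀ * L * (ν • R) + (ν • R)ᵀ * (Lᵀ * L)) =
      Yᵀ * ((2 * ν) • (diagonal s * (B - b • (1 : Matrix (Fin n) (Fin n) ℝ)) * diagonal s) +
        diagonal fun i => if p i then 0 else 2 * ν * b * (t i - τ)) * Y := by
    have e1 : (diagonal (fun i => if p i then 1 else c) * Y)ᵀ *
          diagonal (fun i => if p i then 0 else 1) *
          (diagonal (fun i => if p i then 1 else c) * Y) =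
        Yᵀ * (diagonal fun i => if p i then 0 else 2 * ν * b * τ) * Y := by
      have : (diagonal fun i => if p i then 0 else 2 * ν * b * τ) =
          diagonal (fun i => if p i then 1 else c) * diagonal (fun i => if p i then 0 else 1) *
            diagonal (fun i => if p i then 1 else c) := by
        rw [diagonal_mul_diagonal, diagonal_mul_diagonal]
        congr 1
        ext i
        by_cases hp : p i <;> simp [hp, hcsq]
      rw [this, transpose_mul, diagonal_transpose]
      simp only [Matrix.mul_assoc]
    have e2 : (2 * ν) • (diagonal s * (B - b • (1 : Matrix (Fin n) (Fin n) ℝ)) * diagonal s) +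
        (diagonal fun i => if p i then 0 else 2 * ν * b * (t i - τ)) =
        (2 * ν) • (diagonal s * B * diagonal s) -
          diagonal fun i => if p i then 0 else 2 * ν * b * τ := by
      have : diagonal s * (b • (1 : Matrix (Fin n) (Fin n) ℝ)) * diagonal s =
          b • diagonal t := by
        rw [Matrix.mul_smul, Matrix.mul_one, Matrix.smul_mul, diagonal_mul_diagonal]
        simp only [hss]
      rw [Matrix.mul_sub, Matrix.sub_mul, this, smul_sub, smul_smul]
      have e3 : (diagonal fun i => if p i then 0 else 2 * ν * b * (t i - τ)) =
          (2 * ν * b) • diagonal t - diagonal fun i => if p i then 0 else 2 * ν * b * τ := by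
        rw [← diagonal_smul, diagonal_sub]
        congr 1
        ext i
        by_cases hp : p i
        · simp [hp, ht₀ i hp]
        · simp [hp]
          ring
      rw [e3]
      abel
    rw [e1, e2, transpose_smul, Matrix.mul_smul, Matrix.smul_mul, hA, hA', Matrix.mul_sub,
      Matrix.sub_mul, Matrix.mul_smul, Matrix.smul_mul]
    module
  refine ⟨c, Real.sqrt_pos.mpr (by positivity), ?_⟩
  rw [key]
  have h1 : (diagonal s * (B - b • (1 : Matrix (Fin n) (Fin n) ℝ)) * diagonal s).PosSemidef := by
    have := hB.conjTranspose_mul_mul_same (diagonal s)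
    rwa [conjTranspose_eq_transpose_of_trivial, diagonal_transpose] at this
  have h2 : (diagonal fun i => if p i then 0 else 2 * ν * b * (t i - τ)).PosSemidef := by
    refine PosSemidef.diagonal fun i => ?_
    by_cases hp : p i
    · simp [hp]
    · simp only [hp, if_false, Pi.zero_apply]
      have := sub_nonneg.mpr (ht₁ i hp)
      positivity
  have h3 := ((h1.smul (show (0 : ℝ) ≤ 2 * ν by positivity)).add h2).conjTranspose_mul_mul_same Y
  rwa [conjTranspose_eq_transpose_of_trivial] at h3

lemma lowerBlock_diagonal {n m r : ℕ} (h : m + r = n) (g : ℕ → ℝ) :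
    lowerBlock h (diagonal fun k : Fin r => g k) =
      diagonal fun i : Fin n => if (i : ℕ) < m then 0 else g (i - m) := by
  subst h
  rw [lowerBlock, ← diagonal_zero, fromBlocks_diagonal, reindex_apply, submatrix_diagonal_equiv]
  congr 1
  ext i
  induction i using Fin.addCases <;> simp

lemma lowerBlock_one {n m r : ℕ} (h : m + r = n) :
    lowerBlock h (1 : Matrix (Fin r) (Fin r) ℝ) =
      diagonal fun i : Fin n => if (i : ℕ) < m then 0 else 1 := by
  rw [← diagonal_one]
  exact lowerBlock_diagonal h fun _ => 1

end Coupling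

namespace EQMOM

variable {N : ℕ}

/-- The structural stability condition for a source whose Jacobian is conjugate to a diagonal
matrix, with respect to a matrix `L` of left eigenvectors. -/
lemma exists_structuralStabilityWith (hN : 2 ≤ N) (hdim : 3 + (2 * N - 2) = 2 * N + 1) {S : Moments N → Moments N} {ν : Moments N → ℝ}
    {Y L : Moments N → Matrix (Fin (2 * N + 1)) (Fin (2 * N + 1)) ℝ} {g : ℕ → ℝ} {τ : ℝ}
    (hτ : 0 < τ) (hg : ∀ k, τ ≤ g k) (hν : ∀ M ∈ stateSpace N, 0 < ν M)
    (hνd : ∀ M ∈ momentMap N '' domainEq N, DifferentiableAt ℝ ν M)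
    (hS : ∀ W ∈ domain N, S (momentMap N W) = 0 ↔ W ∈ domainEq N)
    (hL : ∀ M ∈ stateSpace N, IsUnit (L M))
    (hsym : ∀ M ∈ stateSpace N, (L M)ᵀ * L M * coeffMatrix N M =
      (coeffMatrix N M)ᵀ * ((L M)ᵀ * L M))
    (hjac : ∀ M ∈ momentMap N '' domainEq N, DifferentiableAt ℝ S M ∧ IsUnit (Y M) ∧
      Y M * jacobianMatrix S M =
        -diagonal (fun i : Fin (2 * N + 1) => if (i : ℕ) < 3 then 0 else g (i - 3)) * Y M)
    (horth : ∀ M ∈ momentMap N '' domainEq N, ∀ i j : Fin (2 * N + 1),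
      (if (i : ℕ) < 3 then 0 else g (i - 3)) ≠ (if (j : ℕ) < 3 then 0 else g (j - 3)) →
      ((L M * (Y M)⁻¹)ᵀ * (L M * (Y M)⁻¹)) i j = 0) :
    ∃ c : Moments N → ℝ, (∀ M, 0 < c M) ∧
      StructuralStabilityWith hdim (stateSpace N) (fun _ : Fin 1 => coeffMatrix N) (fun M => ν M • S M)
        (fun M => blockScale N (c M) * Y M)
        (fun M => -(ν M • diagonal fun k : Fin (2 * N - 2) => g k))
        (fun M => (L M)ᵀ * L M) := by
  classical
  have heq : ∀ M ∈ equilibriumManifold (stateSpace N) (fun M => ν M • S M),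
      M ∈ momentMap N '' domainEq N ∧ S M = 0 := by
    rintro _ ⟨⟨W, hW, rfl⟩, h⟩
    have h0 : S (momentMap N W) = 0 := (smul_eq_zero.mp h).resolve_left (hν _ ⟨W, hW, rfl⟩).ne'
    exact ⟨⟨W, (hS W hW).mp h0, rfl⟩, h0⟩
  have hsub : ∀ M ∈ momentMap N '' domainEq N, M ∈ stateSpace N := by
    rintro _ ⟨W, hW, rfl⟩
    exact ⟨W, Or.inr hW, rfl⟩
  -- Away from equilibrium nothing is required and the default `c = 1` keeps the function positive.
  have hcoup : ∀ M, ∃ c : ℝ, 0 < c ∧ (M ∈ momentMap N '' domainEq N →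
      (-((blockScale N c * Y M)ᵀ *
          diagonal (fun i : Fin (2 * N + 1) => if (i : ℕ) < 3 then 0 else 1) *
          (blockScale N c * Y M)) - ((L M)ᵀ * L M * (ν M • jacobianMatrix S M) +
            (ν M • jacobianMatrix S M)ᵀ * ((L M)ᵀ * L M))).PosSemidef) := by
    intro M
    by_cases hM : M ∈ momentMap N '' domainEq N
    · obtain ⟨c, hc, h⟩ := exists_coupling (p := fun i : Fin (2 * N + 1) => (i : ℕ) < 3)
        (hL M (hsub M hM)) (hjac M hM).2.1 (hjac M hM).2.2 hτ
        (fun i hi => if_pos hi) (fun i hi => by rw [if_neg hi]; exact hg _)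
        (hν M (hsub M hM)) (horth M hM)
      exact ⟨c, hc, fun _ => h⟩
    · exact ⟨1, one_pos, fun h => absurd h hM⟩
  choose c hc hcoup using hcoup
  have hT : ∀ M, -(ν M • diagonal fun k : Fin (2 * N - 2) => g k) =
      diagonal fun k : Fin (2 * N - 2) => -(ν M * g k) := by
    intro M
    rw [← diagonal_smul, ← diagonal_neg]
    rfl
  refine ⟨c, hc, ⟨by omega, ?_, ?_, ?_, ?_, ?_⟩⟩
  · have hmem : ((fun _ => 1, fun _ => 0, 1) : Params N) ∈ domainEq N :=
      ⟨fun _ => one_pos, one_pos, fun _ _ => rfl⟩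
    refine ⟨momentMap N (fun _ => 1, fun _ => 0, 1), ⟨_, Or.inr hmem, rfl⟩, ?_⟩
    simp only [(hS _ (Or.inr hmem)).mpr hmem, smul_zero]
  · intro M hM
    obtain ⟨hM, h0⟩ := heq M hM
    exact (jacobianMatrix_smul (hνd M hM) (hjac M hM).1 h0).1
  · intro M hM
    obtain ⟨hM, h0⟩ := heq M hM
    have hνM := hν M (hsub M hM)
    have hD : IsUnit (blockScale N (c M)) := by
      rw [isUnit_iff_isUnit_det, blockScale, det_diagonal, isUnit_iff_ne_zero,
        Finset.prod_ne_zero_iff]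
      intro i _
      split_ifs
      · exact one_ne_zero
      · exact (hc M).ne'
    refine ⟨hD.mul (hjac M hM).2.1, ?_, ?_⟩
    · rw [hT, isUnit_iff_isUnit_det, det_diagonal, isUnit_iff_ne_zero, Finset.prod_ne_zero_iff]
      intro i _
      exact neg_ne_zero.mpr (mul_pos hνM (hτ.trans_le (hg _))).ne'
    -- Rescaling the diagonalizer does not alter the diagonal form, since diagonal matrices commute.
    · have hcomm : (diagonal fun i : Fin (2 * N + 1) =>
          if (i : ℕ) < 3 then 0 else -(ν M * g (i - 3))) * blockScale N (c M) =
          ν M • (blockScale N (c M) *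
            -diagonal fun i : Fin (2 * N + 1) => if (i : ℕ) < 3 then 0 else g (i - 3)) := by
        rw [blockScale, diagonal_neg, diagonal_mul_diagonal, diagonal_mul_diagonal, ← diagonal_smul]
        congr 1
        ext i
        by_cases hi : (i : ℕ) < 3
        · simp [hi]
        · simp [hi]
          ring
      rw [(jacobianMatrix_smul (hνd M hM) (hjac M hM).1 h0).2, hT,
        lowerBlock_diagonal _ fun k => -(ν M * g k),
        ← Matrix.mul_assoc _ (blockScale N (c M)), hcomm, Matrix.mul_assoc (blockScale N (c M)),
        Matrix.mul_smul, (hjac M hM).2.2, Matrix.mul_smul, Matrix.smul_mul, Matrix.mul_assoc]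
  · intro M hM
    refine ⟨?_, fun _ => hsym M hM⟩
    have := PosDef.conjTranspose_mul_self (L M) (mulVec_injective_iff_isUnit.mpr (hL M hM))
    rwa [conjTranspose_eq_transpose_of_trivial] at this
  · intro M hM
    obtain ⟨hM, h0⟩ := heq M hM
    rw [(jacobianMatrix_smul (hνd M hM) (hjac M hM).1 h0).2, lowerBlock_one]
    exact hcoup M hM

lemma eigenMatrix_mul_coeffMatrix {M : Moments N} {ev : Fin (2 * N + 1) → ℝ}
    (h : closingCoeff N M = fun j : Fin (2 * N + 1) => -(nodePoly ev).coeff j) :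
    eigenMatrix ev * coeffMatrix N M = diagonal ev * eigenMatrix ev := by
  ext i j
  rw [mul_apply_eq_vecMul, vecMul_eigenMatrix h, diagonal_mul]
  rfl

lemma symmetrizer_eigenMatrix {M : Moments N} {ev : Fin (2 * N + 1) → ℝ}
    (h : closingCoeff N M = fun j : Fin (2 * N + 1) => -(nodePoly ev).coeff j) :
    (eigenMatrix ev)ᵀ * eigenMatrix ev * coeffMatrix N M =
      (coeffMatrix N M)ᵀ * ((eigenMatrix ev)ᵀ * eigenMatrix ev) := by
  rw [Matrix.mul_assoc, ← Matrix.mul_assoc (coeffMatrix N M)ᵀ, ← transpose_mul,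
    eigenMatrix_mul_coeffMatrix h, transpose_mul, diagonal_transpose, Matrix.mul_assoc]

end EQMOM
end

/-! ### Relaxation rates and orthogonality for the two collision models -/

noncomputable section
namespace EQMOM

open Matrix

variable {N : ℕ}

lemma transpose_mul_self_apply_comm (C : Matrix (Fin (2 * N + 1)) (Fin (2 * N + 1)) ℝ)
    (i j : Fin (2 * N + 1)) : (Cᵀ * C) i j = (Cᵀ * C) j i := by
  simp only [mul_apply, transpose_apply]
  exact Finset.sum_congr rfl fun k _ => mul_comm _ _

lemma transpose_mul_self_apply_of_ne {C : Matrix (Fin (2 * N + 1)) (Fin (2 * N + 1)) ℝ}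
    (hC : FirstThreeColumnsOrthogonal C) {g : ℕ → ℝ}
    (hg : ∀ i j : Fin (2 * N + 1), 3 ≤ (i : ℕ) → i < j → g (i - 3) ≠ g (j - 3) →
      (Cᵀ * C) i j = 0) (i j : Fin (2 * N + 1))
    (hij : (if (i : ℕ) < 3 then 0 else g (i - 3)) ≠ (if (j : ℕ) < 3 then 0 else g (j - 3))) :
    (Cᵀ * C) i j = 0 := by
  wlog h : i < j generalizing i j
  · rw [transpose_mul_self_apply_comm]
    refine this j i hij.symm ((not_lt.mp h).lt_of_ne fun e => ?_)
    exact hij (by rw [e])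
  · by_cases hi : (i : ℕ) < 3
    · by_cases hj : (j : ℕ) < 3
      · simp [hi, hj] at hij
      · exact hC i j hi (not_lt.mp hj)
    · have hj : ¬ (j : ℕ) < 3 := fun hj => hi ((Fin.lt_def.mp h).trans hj)
      rw [if_neg hi, if_neg hj] at hij
      exact hg i j (not_lt.mp hi) h hij

lemma lowerOne_sub_fourthUnit (Pr : ℝ) : lowerOne N - (1 - Pr) • fourthUnit N =
    diagonal fun i : Fin (2 * N + 1) =>
      if (i : ℕ) < 3 then 0 else (fun k : ℕ => if k = 0 then Pr else 1) (i - 3) := by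
  rw [lowerOne, fourthUnit, ← diagonal_smul, diagonal_sub]
  congr 1
  ext i
  rcases lt_trichotomy (i : ℕ) 3 with h | h | h
  · simp [h, h.ne]
  · simp [h]
  · simp [h.not_gt, h.ne', show (i : ℕ) - 3 ≠ 0 by omega]

end EQMOM
end

theorem theorem2p2 (N : ℕ) (hN : 2 ≤ N) :
    -- the closure is well defined on the state space and differentiable off equilibrium; the
    -- coefficients at equilibrium are limits
    (∀ W ∈ EQMOM.domain N,
      EQMOM.closingMoment N (EQMOM.momentMap N W) = EQMOM.paramMoment (2 * N + 1) W) ∧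
    IsOpen (EQMOM.momentMap N '' EQMOM.domainOpen N) ∧
    (∀ M ∈ EQMOM.momentMap N '' EQMOM.domainOpen N,
      DifferentiableAt ℝ (EQMOM.closingMoment N) M ∧
      EQMOM.closingCoeff N M = EQMOM.closingGradient N M) ∧
    (∀ W ∈ EQMOM.domainEq N,
      (𝓝[EQMOM.domainOpen N] W).NeBot ∧
      Tendsto (fun W' => EQMOM.closingGradient N (EQMOM.momentMap N W')) (𝓝[EQMOM.domainOpen N] W)
        (𝓝 (EQMOM.closingCoeff N (EQMOM.momentMap N W)))) ∧
    -- equilibrium states of both collision models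
    (∀ W ∈ EQMOM.domain N,
      (EQMOM.bgkSource N (EQMOM.momentMap N W) = 0 ↔ W ∈ EQMOM.domainEq N) ∧
      (∀ Pr : ℝ, 0 < Pr →
        (EQMOM.shakhovSource N Pr (EQMOM.momentMap N W) = 0 ↔ W ∈ EQMOM.domainEq N))) ∧
    (∀ W ∈ EQMOM.domainEq N,
      (∀ i, W.2.1 i = EQMOM.velocity (EQMOM.momentMap N W)) ∧
      W.2.2 = EQMOM.temperature (EQMOM.momentMap N W) ∧
      ∑ i, W.1 i = EQMOM.density (EQMOM.momentMap N W)) ∧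
    -- strict hyperbolicity, and the matrix `L` of normalized left eigenvectors
    ∃ (ev : EQMOM.Moments N → Fin (2 * N + 1) → ℝ)
      (L : EQMOM.Moments N → Matrix (Fin (2 * N + 1)) (Fin (2 * N + 1)) ℝ),
      (∀ M ∈ EQMOM.stateSpace N, StrictMono (ev M) ∧
        ∀ i, Matrix.vecMul (L M i) (EQMOM.coeffMatrix N M) = ev M i • L M i ∧
          L M i (Fin.last (2 * N)) = 1) ∧
      -- orthogonality at equilibrium
      (∀ M ∈ EQMOM.momentMap N '' EQMOM.domainEq N,
        EQMOM.FirstThreeColumnsOrthogonal (L M * (EQMOM.bgkDiagonalizer N M)⁻¹) ∧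
        EQMOM.FirstThreeColumnsOrthogonal (L M * (EQMOM.shakhovDiagonalizer N M)⁻¹)) ∧
      -- structural stability, for every collision frequency `ν` and every Prandtl number `Pr`
      ∀ ν : EQMOM.Moments N → ℝ, (∀ M ∈ EQMOM.stateSpace N, 0 < ν M) →
        (∀ M ∈ EQMOM.momentMap N '' EQMOM.domainEq N, DifferentiableAt ℝ ν M) →
        (StructuralStability (EQMOM.stateSpace N) (fun _ : Fin 1 => EQMOM.coeffMatrix N)
            (fun M => ν M • EQMOM.bgkSource N M) ∧
          ∃ c : EQMOM.Moments N → ℝ, (∀ M, 0 < c M) ∧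
            StructuralStabilityWith (by omega : 3 + (2 * N - 2) = 2 * N + 1)
              (EQMOM.stateSpace N) (fun _ : Fin 1 => EQMOM.coeffMatrix N)
              (fun M => ν M • EQMOM.bgkSource N M)
              (fun M => EQMOM.blockScale N (c M) * EQMOM.bgkDiagonalizer N M)
              (fun M => -(ν M • (1 : Matrix (Fin (2 * N - 2)) (Fin (2 * N - 2)) ℝ)))
              (fun M => (L M).transpose * L M)) ∧
        ∀ Pr : ℝ, 0 < Pr →
          (StructuralStability (EQMOM.stateSpace N) (fun _ : Fin 1 => EQMOM.coeffMatrix N)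
              (fun M => ν M • EQMOM.shakhovSource N Pr M) ∧
            ∃ c : EQMOM.Moments N → ℝ, (∀ M, 0 < c M) ∧
              StructuralStabilityWith (by omega : 3 + (2 * N - 2) = 2 * N + 1)
                (EQMOM.stateSpace N) (fun _ : Fin 1 => EQMOM.coeffMatrix N)
                (fun M => ν M • EQMOM.shakhovSource N Pr M)
                (fun M => EQMOM.blockScale N (c M) * EQMOM.shakhovDiagonalizer N M)
                (fun M => -(ν M • Matrix.diagonal
                  (fun k : Fin (2 * N - 2) => if (k : ℕ) = 0 then Pr else 1)))
                (fun M => (L M).transpose * L M)) := by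
  classical
  have hN0 : NeZero N := ⟨by omega⟩
  -- The eigenvalues are chosen as a total function of `M`, before `ν` and `Pr`, so that one matrix
  -- `L` serves both models.
  have hex : ∀ M : EQMOM.Moments N, ∃ ev : Fin (2 * N + 1) → ℝ, M ∈ EQMOM.stateSpace N →
      StrictMono ev ∧ EQMOM.closingCoeff N M =
        fun j : Fin (2 * N + 1) => -(EQMOM.nodePoly ev).coeff j := by
    intro M
    by_cases hM : M ∈ EQMOM.stateSpace N
    · obtain ⟨ev, h⟩ := EQMOM.exists_closingCoeff_eq hN hM
      exact ⟨ev, fun _ => h⟩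
    · exact ⟨0, fun h => absurd h hM⟩
  choose ev hev using hex
  have hsub : ∀ M ∈ EQMOM.momentMap N '' EQMOM.domainEq N, M ∈ EQMOM.stateSpace N ∧
      EQMOM.density M ≠ 0 ∧ 0 < EQMOM.temperature M ∧ EQMOM.bgkSource N M = 0 := by
    rintro _ ⟨W, hW, rfl⟩
    have hdom : W ∈ EQMOM.domain N := Or.inr hW
    exact ⟨⟨W, hdom, rfl⟩, (EQMOM.density_pos hdom).ne', EQMOM.temperature_pos hdom,
      (EQMOM.bgkSource_eq_zero_iff hN hdom).mpr hW⟩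
  have hherm : ∀ M ∈ EQMOM.momentMap N '' EQMOM.domainEq N, EQMOM.nodePoly (ev M) =
      EQMOM.hermitePoly (EQMOM.velocity M) (EQMOM.temperature M) (2 * N + 1) := fun M hM =>
    EQMOM.nodePoly_eq_hermitePoly hN hM (hev M (hsub M hM).1).2
  have hbgk : ∀ M ∈ EQMOM.momentMap N '' EQMOM.domainEq N, EQMOM.FirstThreeColumnsOrthogonal
      (EQMOM.eigenMatrix (ev M) * (EQMOM.bgkDiagonalizer N M)⁻¹) := fun M hM =>
    EQMOM.bgk_orthogonal hN (hsub M hM).2.1 (hsub M hM).2.2.1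
      (hev M (hsub M hM).1).1.injective (hherm M hM)
  have hshakhov : ∀ M ∈ EQMOM.momentMap N '' EQMOM.domainEq N, EQMOM.FirstThreeColumnsOrthogonal
      (EQMOM.eigenMatrix (ev M) * (EQMOM.shakhovDiagonalizer N M)⁻¹) := fun M hM =>
    EQMOM.shakhov_orthogonal hN (hsub M hM).2.1 (hsub M hM).2.2.1
      (hev M (hsub M hM).1).1.injective (hherm M hM)
  have hunit : ∀ M ∈ EQMOM.stateSpace N, IsUnit (EQMOM.eigenMatrix (ev M)) := fun M hM =>
    EQMOM.isUnit_eigenMatrix (hev M hM).1.injective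
  have hsym := fun M (hM : M ∈ EQMOM.stateSpace N) => EQMOM.symmetrizer_eigenMatrix (hev M hM).2
  refine ⟨fun W hW => EQMOM.closingMoment_momentMap hW, EQMOM.isOpen_momentMap_image, ?_, ?_,
    fun W hW => ⟨EQMOM.bgkSource_eq_zero_iff hN hW, fun Pr hPr =>
      EQMOM.shakhovSource_eq_zero_iff hN hPr hW⟩, fun W hW => ?_,
    ev, fun M => EQMOM.eigenMatrix (ev M), fun M hM => ⟨(hev M hM).1, fun i =>
      ⟨EQMOM.vecMul_eigenMatrix (hev M hM).2 i, EQMOM.coeff_eigenPoly_last (ev M) i⟩⟩,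
    fun M hM => ⟨hbgk M hM, hshakhov M hM⟩, fun ν hν hνd => ⟨?_, fun Pr hPr => ?_⟩⟩
  · rintro _ ⟨W, hW, rfl⟩
    exact ⟨(EQMOM.hasFDerivAt_closingMoment_charPoly hW).differentiableAt,
      if_pos ⟨W, hW, rfl⟩⟩
  · intro W hW
    refine ⟨EQMOM.neBot_nhdsWithin_domainOpen hW, ?_⟩
    rw [EQMOM.closingCoeff_of_mem_domainEq hN hW]
    exact EQMOM.tendsto_closingGradient (EQMOM.velocity_and_temperature_of_mem_domainEq hW).1
  · obtain ⟨h1, h2⟩ := EQMOM.velocity_and_temperature_of_mem_domainEq hW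
    exact ⟨h1, h2, (EQMOM.density_momentMap hW.2.1).symm⟩
  · have key := EQMOM.exists_structuralStabilityWith hN (by omega) (S := EQMOM.bgkSource N)
      (Y := EQMOM.bgkDiagonalizer N) (L := fun M => EQMOM.eigenMatrix (ev M)) (g := fun _ => 1)
      one_pos (fun _ => le_rfl) hν hνd (fun W hW => EQMOM.bgkSource_eq_zero_iff hN hW) hunit hsym
      (fun M hM => by
        obtain ⟨-, hρ, hθ, -⟩ := hsub M hM
        exact ⟨(EQMOM.jacobianMatrix_bgkSource
          (EQMOM.exists_hasFDerivAt_equilibriumMoments hN hρ hθ).1).1,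
          IsUnit.of_mul_eq_one _ (EQMOM.bgkDiagonalizer_mul hN hρ hθ),
          EQMOM.bgkDiagonalizer_mul_jacobianMatrix hN hρ hθ⟩)
      -- All nonzero BGK rates are equal, so orthogonality to the first three columns suffices.
      (fun M hM => EQMOM.transpose_mul_self_apply_of_ne (g := fun _ => 1) (hbgk M hM)
        fun i j _ _ hne => absurd rfl hne)
    simp only [Matrix.diagonal_one] at key
    obtain ⟨c, hc, h⟩ := key
    exact ⟨⟨3, 2 * N - 2, by omega, _, _, _, h⟩, c, hc, h⟩
  · obtain ⟨c, hc, h⟩ := EQMOM.exists_structuralStabilityWith hN (by omega) (S := EQMOM.shakhovSource N Pr)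
      (Y := EQMOM.shakhovDiagonalizer N) (L := fun M => EQMOM.eigenMatrix (ev M))
      -- The uniform lower bound for the rates is the minimum of `Pr` and `1`.
      (g := fun k => if k = 0 then Pr else 1) (lt_min hPr one_pos)
      (fun k => by
        split_ifs
        · exact min_le_left _ _
        · exact min_le_right _ _)
      hν hνd (fun W hW => EQMOM.shakhovSource_eq_zero_iff hN hPr hW) hunit hsym
      (fun M hM => by
        obtain ⟨-, hρ, hθ, h0⟩ := hsub M hM
        refine ⟨(EQMOM.jacobianMatrix_shakhovSource hN hρ hθ h0 Pr).1,
          IsUnit.of_mul_eq_one _ (EQMOM.shakhovDiagonalizer_mul hN hρ hθ), ?_⟩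
        rw [EQMOM.shakhovDiagonalizer_mul_jacobianMatrix hN hρ hθ h0 Pr,
          EQMOM.lowerOne_sub_fourthUnit])
      (fun M hM => EQMOM.transpose_mul_self_apply_of_ne (g := fun k => if k = 0 then Pr else 1)
        (hshakhov M hM) fun i j hi hij hne => by
        obtain ⟨hMs, hρ, hθ, -⟩ := hsub M hM
        have hij' := Fin.lt_def.mp hij
        -- Beyond the first three modes only the fourth can have a different rate, so the smaller
        -- index must be that one.
        have hi3 : (i : ℕ) = 3 := by
          by_contra h3
          simp [show (i : ℕ) - 3 ≠ 0 by omega, show (j : ℕ) - 3 ≠ 0 by omega] at hne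
        exact EQMOM.shakhov_fourth_orthogonal hN hρ hθ (hev M hMs).1.injective (hherm M hM) hi3
          (by omega))
    exact ⟨⟨3, 2 * N - 2, by omega, _, _, _, h⟩, c, hc, h⟩
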